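/- Let $q$ be an odd prime power, let $\xi$ be a primitive element of $\mathbb F_{q^2}$, and let $X_1,X_2,X_3,X_4$ be homogeneous coordinates of ${\rm PG}(3,q^2)$. Let $$\mathcal C=\{(1,t,t^q,t^{q+1}) : t\in\overline{\mathbb F}_{q^2}\}\cup\{(0,0,0,1)\},\qquad \mathcal O=\{(1,t,t^q,t^{q+1}) : t\in\mathbb F_{q^2}\}\cup\{(0,0,0,1)\}.$$ Let $G\le{\rm PGL}(4,q^2)$ be the group of all $\mathbb F_{q^2}$-rational projectivities stabilising the curve $\mathcal C$, let $G'\le{\rm PGL}(4,q^2)$ be the group of all projectivities stabilising $\mathcal O$, and let $\iota:(X_1,X_2,X_3,X_4)\mapsto(X_1,X_3,X_2,X_4)$. Put $h=X_1^qX_4+X_1X_4^q-X_2^{q+1}-X_3^{q+1}$ and $D=X_1X_4-X_2X_3$, and define in ${\rm PG}(3,q^2)$: - $\Sigma=\{(a,b,b^q,c) : a,c\in\mathbb F_q,\ b\in\mathbb F_{q^2}\}$, $\mathcal H(3,q^2): h=0$, $\mathcal Q^+(3,q^2): D=0$; - $\mathcal S_j: h=\bigl(\xi^{j\frac{q-1}2}+\xi^{-j\frac{q-1}2}\bigr)D^{\frac{q+1}2}$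 and $\mathcal E_k: h=\bigl(\xi^{k\frac{q+1}2}+\xi^{-k\frac{q+1}2}\bigr)D^{\frac{q+1}2}$; - $\mathcal H_1$ and $\mathcal H_2$, the orbits of $(\xi^{\frac{q+1}2},0,0,1)$ and of $(0,\xi^{\frac{q-1}2},1,0)$ under the group $K\cong{\rm PSL}(2,q^2)$ of the projectivities induced by $A^{q}\otimes A$, $A\in{\rm SL}(2,q^2)$, where $A^q$ is $A$ with all entries raised to the power $q$; - $\tilde{\mathcal S}_j=(\mathcal S_j\cup\mathcal S_{q+1-j})\setminus\mathcal O$ for $1\le j\le\frac{q-1}2$, $\tilde{\mathcal E}_k=(\mathcal E_k\cup\mathcal E_{q-1-k})\setminus\mathcal O$ for $1\le k\le\frac{q-3}2$, and $\tilde{\mathcal E}_0=(\mathcal E_0\cup\mathcal E_{q-1})\setminus\Sigma$. Then $G\cong{\rm PGL}(2,q^2)$ and $G'=G\rtimes\langle\iota\rangle$; moreover $\mathcal H_1\cup\mathcal H_2=\mathcal H(3,q^2)\setminus\mathcal O$, with $|\mathcal H_1|=q^2(q^2+1)(q-1)/2$ and $|\mathcal H_2|=q^2(q^2+1)(q+1)/2$.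 Each of the groups $G$ and $G'$ has exactly $q+4$ orbits on the points of ${\rm PG}(3,q^2)$, and for both groups the orbits are: $\mathcal O$; $\Sigma\setminus\mathcal O$; $\mathcal Q^+(3,q^2)\setminus\mathcal O$; $\mathcal H_1$; $\mathcal H_2$; $\tilde{\mathcal S}_j$ for $1\le j\le\frac{q-1}2$; $\tilde{\mathcal E}_k$ for $1\le k\le\frac{q-3}2$; and $\tilde{\mathcal E}_0$. -/

import Mathlib

open scoped MatrixGroups LinearAlgebra.Projectivization Pointwise

namespace HermitianVeronese

/-- `PG(3, F)`, the points being the one-dimensional subspaces of `F⁴`. The coordinates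
`X₁, X₂, X₃, X₄` of a vector `v : Fin 4 → F` are `v 0, v 1, v 2, v 3`. The group `PGL(4, F)`
acts on it through Mathlib's action (matrices act on column vectors). -/
abbrev PG3 (F : Type*) [Field F] : Type _ := ℙ F (Fin 4 → F)

section Curve

variable (L : Type*) [Field L]

theorem vec_one_ne_zero (a b c : L) : (![1, a, b, c] : Fin 4 → L) ≠ 0 :=
  fun h => one_ne_zero (congrFun h 0)

theorem vec_last_ne_zero : (![0, 0, 0, 1] : Fin 4 → L) ≠ 0 :=
  fun h => one_ne_zero (congrFun h 3)

/-- The set of points `(1, t, t^q, t^(q+1))`, with `t` in the field `L`, and `(0, 0, 0, 1)`. -/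
def veronese (q : ℕ) : Set (PG3 L) :=
  {P | ∃ t : L, P = .mk L ![1, t, t ^ q, t ^ (q + 1)] (vec_one_ne_zero L _ _ _)} ∪
    {.mk L ![0, 0, 0, 1] (vec_last_ne_zero L)}

end Curve

variable (F : Type*) [Field F]

/-- The point set `𝒪` of `PG(3, q²)` (here `F` is the field of order `q²`). -/
def setO (q : ℕ) : Set (PG3 F) := veronese F q

/-- The curve `𝒞`, as a set of points over the algebraic closure of `F`. -/
def curveC (q : ℕ) : Set (PG3 (AlgebraicClosure F)) := veronese (AlgebraicClosure F) q

/-- The group `G` of all `F`-rational projectivities that map the curve `𝒞` onto itself. -/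
noncomputable def groupG (q : ℕ) : Subgroup PGL(4, F) :=
  (MulAction.stabilizer PGL(4, AlgebraicClosure F) (curveC F q)).comap
    (Matrix.ProjGenLinGroup.map (algebraMap F (AlgebraicClosure F)))

/-- The group `G'` of all `F`-rational projectivities that map `𝒪` onto itself. -/
def groupG' (q : ℕ) : Subgroup PGL(4, F) :=
  MulAction.stabilizer PGL(4, F) (setO F q)

/-- The projectivity `ι : (X₁, X₂, X₃, X₄) ↦ (X₁, X₃, X₂, X₄)`. -/
def iota : PGL(4, F) :=
  Matrix.ProjGenLinGroup.mk
    { val := !![1, 0, 0, 0; 0, 0, 1, 0; 0, 1, 0, 0; 0, 0, 0, 1]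
      inv := !![1, 0, 0, 0; 0, 0, 1, 0; 0, 1, 0, 0; 0, 0, 0, 1]
      val_inv := by
        ext i j; fin_cases i <;> fin_cases j <;> simp [Matrix.mul_apply, Fin.sum_univ_four]
      inv_val := by
        ext i j; fin_cases i <;> fin_cases j <;> simp [Matrix.mul_apply, Fin.sum_univ_four] }

variable {F}

/-- The matrix `A^q ⊗ A`, where `A = (a, b; c, d)` and `A^q = (a^q, b^q; c^q, d^q)`. -/
def frobTensor (q : ℕ) (A : Matrix (Fin 2) (Fin 2) F) : Matrix (Fin 4) (Fin 4) F :=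
  let a := A 0 0
  let b := A 0 1
  let c := A 1 0
  let d := A 1 1
  !![a ^ q * a, a ^ q * b, b ^ q * a, b ^ q * b;
     a ^ q * c, a ^ q * d, b ^ q * c, b ^ q * d;
     c ^ q * a, c ^ q * b, d ^ q * a, d ^ q * b;
     c ^ q * c, c ^ q * d, d ^ q * c, d ^ q * d]

variable (F) in
/-- The set of all projectivities induced by `A^q ⊗ A` with `A ∈ SL(2, F)`. When `F` has order
`q²` this set is the subgroup `K ≅ PSL(2, q²)` of `PGL(4, q²)`. -/
def groupK (q : ℕ) : Set PGL(4, F) :=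
  {g | ∃ (A : SL(2, F)) (M : GL (Fin 4) F),
    (M : Matrix (Fin 4) (Fin 4) F) = frobTensor q (A : Matrix (Fin 2) (Fin 2) F) ∧
      g = Matrix.ProjGenLinGroup.mk M}

variable (F) in
/-- The Baer subgeometry `Σ` of the points `(a, b, b^q, c)` with `a^q = a` and `c^q = c`. -/
def baerSigma (q : ℕ) : Set (PG3 F) :=
  {P | ∃ (a b c : F) (h : ![a, b, b ^ q, c] ≠ 0),
    a ^ q = a ∧ c ^ q = c ∧ P = .mk F ![a, b, b ^ q, c] h}

/-- The Hermitian form `X₁^q X₄ + X₁ X₄^q - X₂^(q+1) - X₃^(q+1)`. -/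
def hermForm (q : ℕ) (v : Fin 4 → F) : F :=
  v 0 ^ q * v 3 + v 0 * v 3 ^ q - v 1 ^ (q + 1) - v 2 ^ (q + 1)

/-- The quadratic form `X₁ X₄ - X₂ X₃`. -/
def quadForm (v : Fin 4 → F) : F := v 0 * v 3 - v 1 * v 2

/-- The points at which the form `φ` vanishes. All forms used below are homogeneous, so that the
condition does not depend on the representative of the point. -/
def zeroLocus (φ : (Fin 4 → F) → F) : Set (PG3 F) := {P | φ P.rep = 0}

variable (F) in
/-- The Hermitian surface `ℋ(3, q²)`. -/
def hermSurface (q : ℕ) : Set (PG3 F) := zeroLocus (hermForm q)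

variable (F) in
/-- The hyperbolic quadric `𝒬⁺(3, q²)`. -/
def hypQuadric : Set (PG3 F) := zeroLocus quadForm

/-- The surface `F_γ = 0`, for `F_γ = (Hermitian form) - γ (quadratic form)^((q+1)/2)`. -/
def surface (q : ℕ) (γ : F) : Set (PG3 F) :=
  zeroLocus fun v => hermForm q v - γ * quadForm v ^ ((q + 1) / 2)

/-- The surface `𝒮_j`, for a primitive element `ξ`. -/
def surfS (q : ℕ) (ξ : F) (j : ℕ) : Set (PG3 F) :=
  surface q (ξ ^ (j * ((q - 1) / 2)) + (ξ ^ (j * ((q - 1) / 2)))⁻¹)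

/-- The surface `ℰ_k`, for a primitive element `ξ`. -/
def surfE (q : ℕ) (ξ : F) (k : ℕ) : Set (PG3 F) :=
  surface q (ξ ^ (k * ((q + 1) / 2)) + (ξ ^ (k * ((q + 1) / 2)))⁻¹)

/-- The point `R_j = (ξ^j, 0, 0, 1)`. -/
def pointR (ξ : F) (j : ℕ) : PG3 F :=
  .mk F ![ξ ^ j, 0, 0, 1] fun h => one_ne_zero (congrFun h 3)

/-- The point `Q_k = (0, ξ^k, 1, 0)`. -/
def pointQ (ξ : F) (k : ℕ) : PG3 F :=
  .mk F ![0, ξ ^ k, 1, 0] fun h => one_ne_zero (congrFun h 2)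

/-- `ℋ₁`, the `K`-orbit of the point `R_((q+1)/2)`. -/
def setH1 (q : ℕ) (ξ : F) : Set (PG3 F) := {P | ∃ g ∈ groupK F q, P = g • pointR ξ ((q + 1) / 2)}

/-- `ℋ₂`, the `K`-orbit of the point `Q_((q-1)/2)`. -/
def setH2 (q : ℕ) (ξ : F) : Set (PG3 F) := {P | ∃ g ∈ groupK F q, P = g • pointQ ξ ((q - 1) / 2)}

/-- `𝒮̃_j = (𝒮_j ∪ 𝒮_(q+1-j)) ∖ 𝒪`. -/
def mergedS (q : ℕ) (ξ : F) (j : ℕ) : Set (PG3 F) :=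
  (surfS q ξ j ∪ surfS q ξ (q + 1 - j)) \ setO F q

/-- `ℰ̃_k = (ℰ_k ∪ ℰ_(q-1-k)) ∖ 𝒪`, for `k ≥ 1`. -/
def mergedE (q : ℕ) (ξ : F) (k : ℕ) : Set (PG3 F) :=
  (surfE q ξ k ∪ surfE q ξ (q - 1 - k)) \ setO F q

/-- `ℰ̃_0 = (ℰ_0 ∪ ℰ_(q-1)) ∖ Σ`. -/
def mergedE0 (q : ℕ) (ξ : F) : Set (PG3 F) :=
  (surfE q ξ 0 ∪ surfE q ξ (q - 1)) \ baerSigma F q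

/-- The set of the orbits of a group of projectivities on the points of `PG(3, F)`. -/
def pointOrbits (H : Subgroup PGL(4, F)) : Set (Set (PG3 F)) :=
  Set.range fun P : PG3 F => MulAction.orbit H P

/-- The list of sets `𝒪`, `Σ ∖ 𝒪`, `𝒬⁺ ∖ 𝒪`, `ℋ₁`, `ℋ₂`, `ℰ̃_0`, `𝒮̃_j` for `1 ≤ j ≤ (q-1)/2` and
`ℰ̃_k` for `1 ≤ k ≤ (q-3)/2`. -/
def orbitList (q : ℕ) (ξ : F) : Set (Set (PG3 F)) :=
  {setO F q, baerSigma F q \ setO F q, hypQuadric F \ setO F q, setH1 q ξ, setH2 q ξ,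
      mergedE0 q ξ} ∪
    {X | ∃ j : ℕ, 1 ≤ j ∧ j ≤ (q - 1) / 2 ∧ X = mergedS q ξ j} ∪
    {X | ∃ k : ℕ, 1 ≤ k ∧ k ≤ (q - 3) / 2 ∧ X = mergedE q ξ k}

end HermitianVeronese

open HermitianVeronese

/-! Write a vector as the 2 × 2 matrix V = (X₁, X₂; X₃, X₄). Then `frobTensor q A` is the map V ↦
A^(q) V Aᵀ, so the point orbits are the classes of sesquilinear forms over F_{q²} up to congruence
and scalars. In this language D = det V, ι is transposition, Σ consists of the multiples of
Hermitian matrices, and 𝒪 consists of the rank-one Hermitian ones. With V* the conjugate transpose,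
det(V - lV*) = D - l h + l² D^q, so h is the middle coefficient of the pencil spanned by V and V*.

Groups. PGL(2, q²) embeds in PGL(4, q²) and acts on 𝒪 as on the projective line, hence
3-transitively. A projectivity that preserves 𝒪 and fixes three suitable points is 1 or ι
(`matrix_eq_of_fixes`): pulling D back along the parametrised curve gives a polynomial of degree at
most 2q + 1 < q² with q² roots. So the image R of PGL(2, q²) satisfies G' = R ∪ Rι. On 𝒪 the element
ι is t ↦ t^q, but on 𝒞 it would force t^(q²) = t on the whole algebraic closure. Hence ι ∉ G and G =
R.

Orbits. Existence of normal forms (`exists_rel_normalForm`): in rank two the discriminant h² -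
4D^(q+1) lies in F_q, so it is a square in F_{q²}, and the pencil contains a singular matrix. A
kernel vector of it either splits off, giving a diagonal form, or is isotropic, giving X₁ = 0.
Norms, Hilbert 90 and inversion then cut the parameters down to the stated ranges.

Separation (`orbitLabel_unique`): D and h are both multiplied by det(A)^(q+1), which lies in F_q, so
h²/D^(q+1) is invariant. It equals x^(q-1) + x^(1-q) + 2 on diag(x, 1) and y^(q+1) + y^(-q-1) + 2 on
antidiag(y, 1). It separates all rank-two normal forms except at two values. At 4 the Hermitian
property decides, and at 0 the square class of D does. In rank one the vanishing of h decides. All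
of these are unchanged by transposition, so ι fuses no orbits. The equations of the merged surfaces
𝒮̃ and ℰ̃ are square roots of the equation for h²/D^(q+1), one for each sign.

For ℋ₁ and ℋ₂, the point stabiliser contains an element of nonsquare determinant, so the K-orbit is
the whole G-orbit; its size follows by counting the monomial matrices in the stabiliser. -/

namespace HermitianVeronese

/-! ### The embedding of PGL(2) in PGL(4) and its action on the curve -/

section Tensor

variable {L : Type*} [Field L] {q : ℕ}

/-- `A^q ⊗ A`, applied to a vector, in coordinates. -/
theorem frobTensor_mulVec (A : Matrix (Fin 2) (Fin 2) L) (v : Fin 4 → L) :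
    (frobTensor q A).mulVec v =
      ![A 0 0 ^ q * (A 0 0 * v 0 + A 0 1 * v 1) + A 0 1 ^ q * (A 0 0 * v 2 + A 0 1 * v 3),
        A 0 0 ^ q * (A 1 0 * v 0 + A 1 1 * v 1) + A 0 1 ^ q * (A 1 0 * v 2 + A 1 1 * v 3),
        A 1 0 ^ q * (A 0 0 * v 0 + A 0 1 * v 1) + A 1 1 ^ q * (A 0 0 * v 2 + A 0 1 * v 3),
        A 1 0 ^ q * (A 1 0 * v 0 + A 1 1 * v 1) + A 1 1 ^ q * (A 1 0 * v 2 + A 1 1 * v 3)] := by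
  ext i
  fin_cases i <;> simp [frobTensor, Matrix.mulVec, dotProduct, Fin.sum_univ_four] <;> ring

theorem frobTensor_one (hq : q ≠ 0) : frobTensor q (1 : Matrix (Fin 2) (Fin 2) L) = 1 := by
  ext i j
  fin_cases i <;> fin_cases j <;> simp [frobTensor, hq]

theorem frobTensor_mul (hadd : ∀ x y : L, (x + y) ^ q = x ^ q + y ^ q)
    (A B : Matrix (Fin 2) (Fin 2) L) :
    frobTensor q (A * B) = frobTensor q A * frobTensor q B := by
  ext i j
  fin_cases i <;> fin_cases j <;>
    simp [frobTensor, Matrix.mul_apply, Fin.sum_univ_four, hadd, mul_pow] <;> ring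

theorem frobTensor_smul (c : L) (A : Matrix (Fin 2) (Fin 2) L) :
    frobTensor q (c • A) = c ^ (q + 1) • frobTensor q A := by
  ext i j
  fin_cases i <;> fin_cases j <;> simp [frobTensor, mul_pow] <;> ring

/-- The homomorphism `A ↦ A^q ⊗ A` on invertible matrices. -/
def frobGL (hq : q ≠ 0) (hadd : ∀ x y : L, (x + y) ^ q = x ^ q + y ^ q) :
    GL (Fin 2) L →* GL (Fin 4) L :=
  Units.map
    { toFun := frobTensor q
      map_one' := frobTensor_one hq
      map_mul' := frobTensor_mul hadd }

theorem coe_frobGL (hq : q ≠ 0) (hadd : ∀ x y : L, (x + y) ^ q = x ^ q + y ^ q)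
    (A : GL (Fin 2) L) : (frobGL hq hadd A : Matrix (Fin 4) (Fin 4) L) = frobTensor q A.1 := rfl

/-- The homomorphism `PGL(2) → PGL(4)` induced by `A ↦ A^q ⊗ A`. -/
def frobPGL (hq : q ≠ 0) (hadd : ∀ x y : L, (x + y) ^ q = x ^ q + y ^ q) :
    PGL(2, L) →* PGL(4, L) :=
  Matrix.ProjGenLinGroup.lift (Matrix.ProjGenLinGroup.mk.comp (frobGL hq hadd)) <| by
    ext1 u
    have h : frobGL hq hadd (Matrix.GeneralLinearGroup.scalar (Fin 2) u) =
        Matrix.GeneralLinearGroup.scalar (Fin 4) (u ^ (q + 1)) := by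
      apply Units.ext
      rw [coe_frobGL]
      ext i j
      generalize hw : u ^ (q + 1) = w
      have hw' : (u : L) ^ q * u = w := by rw [← hw, Units.val_pow_eq_pow_val, pow_succ]
      fin_cases i <;> fin_cases j <;> simp [frobTensor, hq, hw']
    simp [h]

theorem frobPGL_mk (hq : q ≠ 0) (hadd : ∀ x y : L, (x + y) ^ q = x ^ q + y ^ q)
    (A : GL (Fin 2) L) :
    frobPGL hq hadd (.mk A) = Matrix.ProjGenLinGroup.mk (frobGL hq hadd A) := rfl

/-- The corner entries b^(q+1) and c^(q+1) of a scalar A^q ⊗ A vanish, so A is diagonal; then the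
equal diagonal entries a^q a and a^q d give a = d. -/
theorem frobPGL_injective (hq : q ≠ 0) (hadd : ∀ x y : L, (x + y) ^ q = x ^ q + y ^ q) :
    Function.Injective (frobPGL (L := L) hq hadd) := by
  rw [injective_iff_map_eq_one]
  intro g hg
  induction g using Matrix.ProjGenLinGroup.induction_on with | mk A =>
  rw [frobPGL_mk, Matrix.ProjGenLinGroup.mk_eq_one,
    Matrix.GeneralLinearGroup.mem_center_iff_val_mem_range_scalar] at hg
  obtain ⟨r, hr⟩ := hg
  rw [coe_frobGL] at hr
  rw [Matrix.ProjGenLinGroup.mk_eq_one,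
    Matrix.GeneralLinearGroup.mem_center_iff_val_mem_range_scalar]
  have hdet : A.1 0 0 * A.1 1 1 - A.1 0 1 * A.1 1 0 ≠ 0 := by
    rw [← Matrix.det_fin_two]
    exact A.det_ne_zero
  have e (i j : Fin 4) := congrFun (congrFun hr i) j
  have h03 := e 0 3
  have h30 := e 3 0
  have h01 := e 0 0
  have h11 := e 1 1
  simp [frobTensor, hq] at h03 h30 h01 h11
  rw [h03, h30] at hdet
  have h0 : A.1 0 0 ≠ 0 := by rintro h; simp [h] at hdet
  have h1 : A.1 0 0 = A.1 1 1 := by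
    have := h01.symm.trans h11
    exact mul_left_cancel₀ (pow_ne_zero q h0) this
  refine ⟨A.1 0 0, ?_⟩
  ext i j
  fin_cases i <;> fin_cases j <;> simp [h03, h30, h1]

/-- The image of the point with coordinates `u` of the projective line on the curve. -/
def ver (q : ℕ) (u : Fin 2 → L) : Fin 4 → L :=
  ![u 0 ^ (q + 1), u 0 ^ q * u 1, u 1 ^ q * u 0, u 1 ^ (q + 1)]

theorem ver_ne_zero {u : Fin 2 → L} (hu : u ≠ 0) : ver q u ≠ 0 := by
  contrapose! hu
  have h0 := congrFun hu 0
  have h3 := congrFun hu 3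
  simp [ver] at h0 h3
  ext i
  fin_cases i <;> simp [h0, h3]

theorem frobTensor_mulVec_ver (hadd : ∀ x y : L, (x + y) ^ q = x ^ q + y ^ q)
    (A : Matrix (Fin 2) (Fin 2) L) (u : Fin 2 → L) :
    (frobTensor q A).mulVec (ver q u) = ver q (A.mulVec u) := by
  rw [frobTensor_mulVec]
  ext i
  fin_cases i <;> simp [ver, Matrix.mulVec, dotProduct, pow_succ, hadd, mul_pow] <;> ring

theorem ver_smul (c : L) (u : Fin 2 → L) : ver q (c • u) = c ^ (q + 1) • ver q u := by
  ext i
  fin_cases i <;> simp [ver, mul_pow] <;> ring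

/-- Homogeneous parametrisation by the projective line, in which the last point is no longer
exceptional and the group acts linearly on the parameter. -/
theorem mem_veronese_iff (hq : q ≠ 0) {P : PG3 L} :
    P ∈ veronese L q ↔ ∃ (u : Fin 2 → L) (hu : u ≠ 0), P = .mk L (ver q u) (ver_ne_zero hu) := by
  constructor
  · rintro (⟨t, rfl⟩ | rfl)
    · refine ⟨![1, t], fun h => one_ne_zero (congrFun h 0), ?_⟩
      congr 1
      simp [ver]
    · refine ⟨![0, 1], fun h => one_ne_zero (congrFun h 1), ?_⟩
      congr 1
      simp [ver, hq]
  · rintro ⟨u, hu, rfl⟩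
    by_cases h0 : u 0 = 0
    · right
      have h1 : u 1 ≠ 0 := by
        contrapose! hu
        ext i
        fin_cases i <;> simp [h0, hu]
      rw [Set.mem_singleton_iff, Projectivization.mk_eq_mk_iff']
      refine ⟨u 1 ^ (q + 1), ?_⟩
      ext i
      fin_cases i <;> simp [ver, h0, hq]
    · left
      refine ⟨u 1 / u 0, ?_⟩
      rw [Projectivization.mk_eq_mk_iff']
      refine ⟨u 0 ^ (q + 1), ?_⟩
      ext i
      fin_cases i <;> simp [ver, div_pow] <;> field_simp <;> ring

theorem mk_smul_mk (M : GL (Fin 4) L) {v : Fin 4 → L} (hv : v ≠ 0) {w : Fin 4 → L} (hw : w ≠ 0)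
    (h : M.1.mulVec v = w) :
    (Matrix.ProjGenLinGroup.mk M : PGL(4, L)) • (Projectivization.mk L v hv : PG3 L) =
      .mk L w hw := by
  subst h
  rfl

theorem mulVec_ne_zero {n : Type*} [Fintype n] [DecidableEq n] (M : GL n L) {v : n → L}
    (hv : v ≠ 0) : M.1.mulVec v ≠ 0 := by
  intro h
  apply hv
  have := congrArg (M⁻¹).1.mulVec h
  rwa [Matrix.mulVec_mulVec, ← Units.val_mul, inv_mul_cancel, Units.val_one, Matrix.one_mulVec,
    Matrix.mulVec_zero] at this

theorem frobPGL_smul_ver (hq : q ≠ 0) (hadd : ∀ x y : L, (x + y) ^ q = x ^ q + y ^ q)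
    (A : GL (Fin 2) L) {u : Fin 2 → L} (hu : u ≠ 0) :
    frobPGL hq hadd (.mk A) • (Projectivization.mk L (ver q u) (ver_ne_zero hu) : PG3 L) =
      .mk L (ver q (A.1.mulVec u)) (ver_ne_zero (mulVec_ne_zero A hu)) := by
  rw [frobPGL_mk]
  exact mk_smul_mk _ _ _ (frobTensor_mulVec_ver hadd _ _)

theorem mem_stabilizer_of_smul_mem {G X : Type*} [Group G] [MulAction G X] {s : Set X}
    {H : Subgroup G} (h : ∀ g ∈ H, ∀ x ∈ s, g • x ∈ s) : H ≤ MulAction.stabilizer G s := by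
  intro g hg
  rw [MulAction.mem_stabilizer_set]
  refine fun x => ⟨fun hx => ?_, h g hg x⟩
  simpa using h _ (H.inv_mem hg) _ hx

/-- The group induced by `A ↦ A^q ⊗ A` leaves the curve invariant. -/
theorem range_frobPGL_le_stabilizer (hq : q ≠ 0)
    (hadd : ∀ x y : L, (x + y) ^ q = x ^ q + y ^ q) :
    (frobPGL (L := L) hq hadd).range ≤ MulAction.stabilizer PGL(4, L) (veronese L q) := by
  apply mem_stabilizer_of_smul_mem
  rintro _ ⟨g, rfl⟩ x hx
  induction g using Matrix.ProjGenLinGroup.induction_on with | mk A =>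
  obtain ⟨u, hu, rfl⟩ := (mem_veronese_iff hq).1 hx
  rw [frobPGL_smul_ver hq hadd A hu, mem_veronese_iff hq]
  exact ⟨_, mulVec_ne_zero A hu, rfl⟩

end Tensor

/-! ### Arithmetic of the field of order q² -/

section FiniteField

variable {F : Type*} [Field F] [Fintype F] {q : ℕ}

theorem three_le_of_card (hq : Odd q) (hF : Fintype.card F = q ^ 2) : 3 ≤ q := by
  have h1 : 1 < Fintype.card F := Fintype.one_lt_card
  obtain ⟨k, rfl⟩ := hq
  rcases k with _ | k
  · simp [hF] at h1
  · omega

/-- Dividing q², the number q is a power of the characteristic. The extension field `L` is there so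
that this also applies to the algebraic closure. -/
theorem add_pow_of_card (hF : Fintype.card F = q ^ 2) {L : Type*} [Field L] [Algebra F L]
    (x y : L) : (x + y) ^ q = x ^ q + y ^ q := by
  obtain ⟨p, hp, n, hprime, hn⟩ := FiniteField.card' F
  have : Fact p.Prime := ⟨hprime⟩
  have : CharP L p := charP_of_injective_algebraMap (algebraMap F L).injective p
  obtain ⟨k, -, rfl⟩ := (Nat.dvd_prime_pow hprime).1 (hn ▸ hF ▸ Dvd.intro_left q (sq q).symm)
  exact add_pow_char_pow x y p k

theorem pow_pow_of_card (hF : Fintype.card F = q ^ 2) (x : F) : (x ^ q) ^ q = x := by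
  rw [← pow_mul, ← sq, ← hF, FiniteField.pow_card]

theorem two_ne_zero_of_card (hq : Odd q) (hF : Fintype.card F = q ^ 2) : (2 : F) ≠ 0 := by
  apply Ring.two_ne_zero
  intro h
  have := FiniteField.even_card_iff_char_two.1 h
  rw [hF] at this
  have := (Nat.odd_iff.1 (hq.pow (n := 2)))
  omega

end FiniteField

/-! ### Projectivities fixing three points of 𝒪 -/

section Stabilizer

variable {F : Type*} [Field F] {q : ℕ}

/-- `ι` swaps the two middle coordinates. -/
theorem iota_smul_mk {v : Fin 4 → F} (hv : v ≠ 0) {w : Fin 4 → F} (hw : w ≠ 0)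
    (h : w = ![v 0, v 2, v 1, v 3]) :
    iota F • (Projectivization.mk F v hv : PG3 F) = .mk F w hw := by
  apply mk_smul_mk
  rw [h]
  ext i
  fin_cases i <;> simp [Matrix.mulVec, dotProduct, Fin.sum_univ_four]

theorem iota_mul_iota : iota F * iota F = 1 := by
  rw [iota, ← map_mul]
  rw [← map_one Matrix.ProjGenLinGroup.mk]
  congr 1
  ext i j
  fin_cases i <;> fin_cases j <;> simp [Matrix.mul_apply, Fin.sum_univ_four]

theorem mem_zpowers_iota {g : PGL(4, F)} : g ∈ Subgroup.zpowers (iota F) ↔ g = 1 ∨ g = iota F := by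
  constructor
  · rintro ⟨n, rfl⟩
    rcases Int.even_or_odd' n with ⟨k, rfl | rfl⟩
    · left
      simp [zpow_mul, zpow_ofNat, sq, iota_mul_iota]
    · right
      simp [zpow_add, zpow_mul, zpow_ofNat, sq, iota_mul_iota]
  · rintro (rfl | rfl)
    · exact one_mem _
    · exact Subgroup.mem_zpowers _

theorem mk_ver_eq_of_det_eq_zero {u w : Fin 2 → F} (hu : u ≠ 0) (hw : w ≠ 0)
    (h : u 0 * w 1 = u 1 * w 0) :
    (Projectivization.mk F (ver q u) (ver_ne_zero hu) : PG3 F) =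
      .mk F (ver q w) (ver_ne_zero hw) := by
  obtain ⟨c, hc⟩ : ∃ c : F, c • w = u := by
    by_cases h0 : w 0 = 0
    · have h1 : w 1 ≠ 0 := by
        contrapose! hw
        ext i
        fin_cases i <;> simp [h0, hw]
      refine ⟨u 1 / w 1, ?_⟩
      rw [h0, mul_zero, mul_eq_zero, or_iff_left h1] at h
      ext i
      fin_cases i <;> simp [h0, h, h1]
    · refine ⟨u 0 / w 0, ?_⟩
      ext i
      fin_cases i
      · simp [h0]
      · simp
        field_simp
        linear_combination h
  rw [Projectivization.mk_eq_mk_iff']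
  exact ⟨c ^ (q + 1), by rw [← hc, ver_smul]⟩

/-- The polynomial has q² roots and degree at most 2q + 1 < q². The bound 3 ≤ q gives this
inequality and also makes the seven exponents distinct. -/
theorem coeffs_eq_zero_of_eval_eq_zero [Fintype F] (hq3 : 3 ≤ q) (hF : Fintype.card F = q ^ 2)
    {c₁ c₂ c₃ c₄ c₅ c₆ c₇ : F}
    (h : ∀ t : F, c₁ * t ^ 1 + c₂ * t ^ 2 + c₃ * t ^ q + c₄ * t ^ (q + 1) + c₅ * t ^ (q + 2) +
      c₆ * t ^ (2 * q) + c₇ * t ^ (2 * q + 1) = 0) :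
    c₁ = 0 ∧ c₂ = 0 ∧ c₃ = 0 ∧ c₄ = 0 ∧ c₅ = 0 ∧ c₆ = 0 ∧ c₇ = 0 := by
  open Polynomial in
  let p : F[X] := C c₁ * X ^ 1 + C c₂ * X ^ 2 + C c₃ * X ^ q + C c₄ * X ^ (q + 1) +
    C c₅ * X ^ (q + 2) + C c₆ * X ^ (2 * q) + C c₇ * X ^ (2 * q + 1)
  have hdeg : p.natDegree ≤ 2 * q + 1 := by
    rw [Polynomial.natDegree_le_iff_coeff_eq_zero]
    intro N hN
    simp only [p, Polynomial.coeff_add, Polynomial.coeff_C_mul, Polynomial.coeff_X_pow]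
    simp (disch := omega) only [if_neg]
    simp
  have hp : p = 0 := by
    apply Polynomial.eq_zero_of_natDegree_lt_card_of_eval_eq_zero p Function.injective_id
    · intro t
      simpa [p] using h t
    · rw [hF]
      nlinarith
  have hc (n : ℕ) : p.coeff n = 0 := by rw [hp, Polynomial.coeff_zero]
  simp only [p, Polynomial.coeff_add, Polynomial.coeff_C_mul, Polynomial.coeff_X_pow] at hc
  refine ⟨?_, ?_, ?_, ?_, ?_, ?_, ?_⟩
  · have := hc 1
    simp (disch := omega) only [if_neg] at this
    simpa using this
  · have := hc 2
    simp (disch := omega) only [if_neg] at this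
    simpa using this
  · have := hc q
    simp (disch := omega) only [if_neg] at this
    simpa using this
  · have := hc (q + 1)
    simp (disch := omega) only [if_neg] at this
    simpa using this
  · have := hc (q + 2)
    simp (disch := omega) only [if_neg] at this
    simpa using this
  · have := hc (2 * q)
    simp (disch := omega) only [if_neg] at this
    simpa using this
  · have := hc (2 * q + 1)
    simp (disch := omega) only [if_neg] at this
    simpa using this

theorem matrix_eq_of_fixes [Fintype F] (hq3 : 3 ≤ q) (hF : Fintype.card F = q ^ 2)
    {M : Matrix (Fin 4) (Fin 4) F} {α δ ε : F} (hα : α ≠ 0) (hδ : δ ≠ 0) (hε : ε ≠ 0)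
    (h0 : M.mulVec ![1, 0, 0, 0] = α • ![1, 0, 0, 0])
    (h1 : M.mulVec ![0, 0, 0, 1] = δ • ![0, 0, 0, 1])
    (h2 : M.mulVec ![1, 1, 1, 1] = ε • ![1, 1, 1, 1])
    (hD : ∀ t : F, quadForm (M.mulVec ![1, t, t ^ q, t ^ (q + 1)]) = 0) :
    M = ε • 1 ∨ M = ε • !![1, 0, 0, 0; 0, 0, 1, 0; 0, 1, 0, 0; 0, 0, 0, 1] := by
  have h00 := congrFun h0 0
  have h01 := congrFun h0 1
  have h02 := congrFun h0 2
  have h03 := congrFun h0 3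
  have h10 := congrFun h1 0
  have h11 := congrFun h1 1
  have h12 := congrFun h1 2
  have h13 := congrFun h1 3
  have h20 := congrFun h2 0
  have h21 := congrFun h2 1
  have h22 := congrFun h2 2
  have h23 := congrFun h2 3
  simp [Matrix.mulVec, dotProduct, Fin.sum_univ_four] at h00 h01 h02 h03 h10 h11 h12 h13
  simp [Matrix.mulVec, dotProduct, Fin.sum_univ_four, h00, h01, h02, h03, h10, h11, h12, h13]
    at h20 h21 h22 h23
  simp [quadForm, Matrix.mulVec, dotProduct, Fin.sum_univ_four, h00, h01, h02, h03, h10, h11, h12,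
    h13] at hD
  -- The first and last columns of M are multiples of unit vectors, so D(M(1, t, t^q, t^(q+1))) has
  -- no constant term and no term in t^(2q+2); these are its remaining coefficients.
  have := coeffs_eq_zero_of_eval_eq_zero hq3 hF
    (c₁ := α * M 3 1) (c₂ := M 0 1 * M 3 1 - M 1 1 * M 2 1) (c₃ := α * M 3 2)
    (c₄ := α * δ + M 0 1 * M 3 2 + M 0 2 * M 3 1 - M 1 1 * M 2 2 - M 1 2 * M 2 1)
    (c₅ := M 0 1 * δ) (c₆ := M 0 2 * M 3 2 - M 1 2 * M 2 2) (c₇ := M 0 2 * δ) (fun t => by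
      rw [← hD t]; ring)
  simp only [mul_eq_zero, hα, hδ, false_or, or_false] at this
  obtain ⟨h31, h2', h32, h4, h01', h6, h02'⟩ := this
  rw [h31, h01'] at h2'
  rw [h02', h32] at h6
  simp only [h01', h02', h31, h32, mul_zero, zero_sub, neg_eq_zero, mul_eq_zero,
    add_zero, zero_add] at h2' h6 h4 h20 h23
  subst h20 h23
  -- In the middle block each column has product zero, while each row sums to the common scalar;
  -- this leaves the identity and the swap.
  by_cases h11' : M 1 1 = 0
  · right
    have h12' : M 1 2 = δ := by simpa [h11'] using h21
    have h22' : M 2 2 = 0 := by simpa [h12', hδ] using h6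
    have h21' : M 2 1 = δ := by simpa [h22'] using h22
    ext i j
    fin_cases i <;> fin_cases j <;> simp [*]
  · left
    have h21' : M 2 1 = 0 := by simpa [h11'] using h2'
    have h22' : M 2 2 = δ := by simpa [h21'] using h22
    have h12' : M 1 2 = 0 := by simpa [h22', hδ] using h6
    have h11'' : M 1 1 = δ := by simpa [h12'] using h21
    ext i j
    fin_cases i <;> fin_cases j <;> simp [*]

end Stabilizer

/-! ### The structure of G and G' -/

section Groups

variable {F : Type*} [Field F] {q : ℕ}

/-- A projectivity stabilising `𝒪` and fixing three of its points is `1` or `ι`. -/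
theorem eq_one_or_eq_iota (hq3 : 3 ≤ q) [Fintype F] (hF : Fintype.card F = q ^ 2) {g : PGL(4, F)}
    (hg : g ∈ groupG' F q)
    (h0 : g • (.mk F ![1, 0, 0, 0] (vec_one_ne_zero F _ _ _) : PG3 F) =
      .mk F ![1, 0, 0, 0] (vec_one_ne_zero F _ _ _))
    (h1 : g • (.mk F ![0, 0, 0, 1] (vec_last_ne_zero F) : PG3 F) =
      .mk F ![0, 0, 0, 1] (vec_last_ne_zero F))
    (h2 : g • (.mk F ![1, 1, 1, 1] (vec_one_ne_zero F _ _ _) : PG3 F) =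
      .mk F ![1, 1, 1, 1] (vec_one_ne_zero F _ _ _)) :
    g = 1 ∨ g = iota F := by
  induction g using Matrix.ProjGenLinGroup.induction_on with | mk M =>
  rw [mk_smul_mk M _ (mulVec_ne_zero M (vec_one_ne_zero F _ _ _)) rfl,
    Projectivization.mk_eq_mk_iff] at h0 h2
  rw [mk_smul_mk M _ (mulVec_ne_zero M (vec_last_ne_zero F)) rfl,
    Projectivization.mk_eq_mk_iff] at h1
  obtain ⟨α, h0⟩ := h0
  obtain ⟨δ, h1⟩ := h1
  obtain ⟨ε, h2⟩ := h2
  have hD (t : F) : quadForm (M.1.mulVec ![1, t, t ^ q, t ^ (q + 1)]) = 0 := by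
    have := (MulAction.mem_stabilizer_set.1 hg
      (.mk F ![1, t, t ^ q, t ^ (q + 1)] (vec_one_ne_zero F _ _ _))).2 (Or.inl ⟨t, rfl⟩)
    rw [mk_smul_mk M _ (mulVec_ne_zero M (vec_one_ne_zero F _ _ _)) rfl, setO,
      mem_veronese_iff (by omega)] at this
    obtain ⟨u, hu, h⟩ := this
    obtain ⟨c, hc⟩ := (Projectivization.mk_eq_mk_iff' _ _ _ _ _).1 h
    rw [← hc]
    simp [quadForm, ver]
    ring
  have hMM := matrix_eq_of_fixes hq3 hF α.ne_zero δ.ne_zero ε.ne_zero h0.symm h1.symm h2.symm hD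
  rcases hMM with h | h
  · left
    rw [Matrix.ProjGenLinGroup.mk_eq_one,
      Matrix.GeneralLinearGroup.mem_center_iff_val_mem_range_scalar]
    exact ⟨ε, by rw [h, Matrix.smul_one_eq_diagonal]; rfl⟩
  · right
    rw [iota, eq_comm, Matrix.ProjGenLinGroup.mk_eq_mk_iff]
    refine ⟨ε, ?_⟩
    apply Units.ext
    rw [h]
    ext i j
    fin_cases i <;> fin_cases j <;> simp [Matrix.mul_apply, Fin.sum_univ_four]

/-- On 𝒪 the swap is the Frobenius map u ↦ u^q of the parameter, because the q²-power map is trivial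
on F. -/
theorem iota_mem_groupG' (hq0 : q ≠ 0) [Fintype F] (hF : Fintype.card F = q ^ 2) : iota F ∈ groupG' F q := by
  refine mem_stabilizer_of_smul_mem (H := Subgroup.zpowers (iota F)) (fun g hg x hx => ?_)
    (Subgroup.mem_zpowers _)
  rcases mem_zpowers_iota.1 hg with rfl | rfl
  · rwa [one_smul]
  · rw [setO, mem_veronese_iff hq0] at hx ⊢
    obtain ⟨u, hu, rfl⟩ := hx
    have hu' : (fun i => u i ^ q) ≠ 0 := by
      contrapose! hu
      ext i
      simpa [hq0] using congrFun hu i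
    refine ⟨fun i => u i ^ q, hu', iota_smul_mk _ _ ?_⟩
    ext i
    fin_cases i <;> simp [ver, pow_succ, pow_pow_of_card hF] <;> ring

variable (hq0 : q ≠ 0) (hadd : ∀ x y : F, (x + y) ^ q = x ^ q + y ^ q)

theorem range_frobPGL_le_groupG' : (frobPGL hq0 hadd).range ≤ groupG' F q :=
  range_frobPGL_le_stabilizer hq0 hadd

theorem mem_range_or_mul_iota_mem_range (hq3 : 3 ≤ q) [Fintype F] (hF : Fintype.card F = q ^ 2)
    {g : PGL(4, F)} (hg : g ∈ groupG' F q) :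
    g ∈ (frobPGL hq0 hadd).range ∨ g * iota F ∈ (frobPGL hq0 hadd).range := by
  have key {u : Fin 2 → F} (hu : u ≠ 0) : ∃ (w : Fin 2 → F) (hw : w ≠ 0),
      g • (Projectivization.mk F (ver q u) (ver_ne_zero hu) : PG3 F) =
        .mk F (ver q w) (ver_ne_zero hw) :=
    (mem_veronese_iff hq0).1 <| (MulAction.mem_stabilizer_set.1 hg _).2 <|
      (mem_veronese_iff hq0).2 ⟨u, hu, rfl⟩
  have e0 : (![1, 0] : Fin 2 → F) ≠ 0 := fun h => one_ne_zero (congrFun h 0)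
  have e1 : (![0, 1] : Fin 2 → F) ≠ 0 := fun h => one_ne_zero (congrFun h 1)
  have e2 : (![1, 1] : Fin 2 → F) ≠ 0 := fun h => one_ne_zero (congrFun h 1)
  obtain ⟨u, hu, gu⟩ := key e0
  obtain ⟨w, hw, gw⟩ := key e1
  obtain ⟨z, hz, gz⟩ := key e2
  have huw : u 0 * w 1 - u 1 * w 0 ≠ 0 := by
    intro h
    have := mk_ver_eq_of_det_eq_zero (q := q) hu hw (sub_eq_zero.1 h)
    rw [← gu, ← gw] at this
    obtain ⟨c, hc⟩ := (Projectivization.mk_eq_mk_iff' _ _ _ _ _).1 (smul_left_cancel _ this)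
    simpa [ver, hq0] using congrFun hc 0
  have huz : u 0 * z 1 - u 1 * z 0 ≠ 0 := by
    intro h
    have := mk_ver_eq_of_det_eq_zero (q := q) hu hz (sub_eq_zero.1 h)
    rw [← gu, ← gz] at this
    obtain ⟨c, hc⟩ := (Projectivization.mk_eq_mk_iff' _ _ _ _ _).1 (smul_left_cancel _ this)
    have h3 := congrFun hc 3
    have h0 := congrFun hc 0
    simp [ver, hq0] at h3 h0
    simp [h3] at h0
  have hzw : z 0 * w 1 - z 1 * w 0 ≠ 0 := by
    intro h
    have := mk_ver_eq_of_det_eq_zero (q := q) hz hw (sub_eq_zero.1 h)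
    rw [← gz, ← gw] at this
    obtain ⟨c, hc⟩ := (Projectivization.mk_eq_mk_iff' _ _ _ _ _).1 (smul_left_cancel _ this)
    simpa [ver, hq0] using congrFun hc 0
  set d := u 0 * w 1 - u 1 * w 0 with hd
  -- Cramer's rule: z = αu + βw, so the matrix with columns αu and βw sends the three standard
  -- points of the line to u, w and z.
  set α := (z 0 * w 1 - z 1 * w 0) / d with hα
  set β := (u 0 * z 1 - u 1 * z 0) / d with hβ
  have hα0 : α ≠ 0 := div_ne_zero hzw huw
  have hβ0 : β ≠ 0 := div_ne_zero huz huw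
  let A : GL (Fin 2) F := Matrix.GeneralLinearGroup.mkOfDetNeZero
    !![α * u 0, β * w 0; α * u 1, β * w 1] (by
      rw [Matrix.det_fin_two_of]
      have : α * u 0 * (β * w 1) - β * w 0 * (α * u 1) = α * β * d := by rw [hd]; ring
      rw [this]
      exact mul_ne_zero (mul_ne_zero hα0 hβ0) huw)
  have hA : A.1 = !![α * u 0, β * w 0; α * u 1, β * w 1] := rfl
  have hA0 : A.1.mulVec ![1, 0] = α • u := by
    rw [hA]; ext i; fin_cases i <;> simp [Matrix.mulVec, dotProduct]
  have hA1 : A.1.mulVec ![0, 1] = β • w := by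
    rw [hA]; ext i; fin_cases i <;> simp [Matrix.mulVec, dotProduct]
  have hA2 : A.1.mulVec ![1, 1] = z := by
    rw [hA]; ext i
    fin_cases i <;> simp [Matrix.mulVec, dotProduct, hα, hβ] <;> field_simp <;> rw [hd] <;> ring
  have hφ : frobPGL hq0 hadd (.mk A) ∈ (frobPGL hq0 hadd).range := ⟨_, rfl⟩
  set φ := frobPGL hq0 hadd (.mk A) with hφ'
  have f0 : φ⁻¹ * g ∈ groupG' F q :=
    mul_mem (inv_mem (range_frobPGL_le_groupG' hq0 hadd hφ)) hg
  have p0 : φ • (Projectivization.mk F (ver q ![1, 0]) (ver_ne_zero e0) : PG3 F) =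
      .mk F (ver q u) (ver_ne_zero hu) := by
    rw [hφ', frobPGL_smul_ver hq0 hadd A e0]
    refine mk_ver_eq_of_det_eq_zero (mulVec_ne_zero A e0) hu ?_
    rw [hA0, Pi.smul_apply, Pi.smul_apply, smul_eq_mul, smul_eq_mul]; ring
  have p1 : φ • (Projectivization.mk F (ver q ![0, 1]) (ver_ne_zero e1) : PG3 F) =
      .mk F (ver q w) (ver_ne_zero hw) := by
    rw [hφ', frobPGL_smul_ver hq0 hadd A e1]
    refine mk_ver_eq_of_det_eq_zero (mulVec_ne_zero A e1) hw ?_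
    rw [hA1, Pi.smul_apply, Pi.smul_apply, smul_eq_mul, smul_eq_mul]; ring
  have p2 : φ • (Projectivization.mk F (ver q ![1, 1]) (ver_ne_zero e2) : PG3 F) =
      .mk F (ver q z) (ver_ne_zero hz) := by
    rw [hφ', frobPGL_smul_ver hq0 hadd A e2]
    refine mk_ver_eq_of_det_eq_zero (mulVec_ne_zero A e2) hz ?_
    rw [hA2, mul_comm]
  have v0 : (Projectivization.mk F (ver q ![1, 0]) (ver_ne_zero e0) : PG3 F) =
      .mk F ![1, 0, 0, 0] (vec_one_ne_zero F _ _ _) := by congr 1; simp [ver, hq0]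
  have v1 : (Projectivization.mk F (ver q ![0, 1]) (ver_ne_zero e1) : PG3 F) =
      .mk F ![0, 0, 0, 1] (vec_last_ne_zero F) := by congr 1; simp [ver, hq0]
  have v2 : (Projectivization.mk F (ver q ![1, 1]) (ver_ne_zero e2) : PG3 F) =
      .mk F ![1, 1, 1, 1] (vec_one_ne_zero F _ _ _) := by congr 1; simp [ver]
  rcases eq_one_or_eq_iota hq3 hF f0 (by rw [← v0, mul_smul, gu, ← p0, inv_smul_smul])
    (by rw [← v1, mul_smul, gw, ← p1, inv_smul_smul])
    (by rw [← v2, mul_smul, gz, ← p2, inv_smul_smul]) with h | h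
  · left
    rwa [← inv_mul_eq_one.1 h]
  · right
    rwa [inv_mul_eq_iff_eq_mul.1 h, mul_assoc, iota_mul_iota, mul_one]

/-- A point of the curve with coordinates in `F` lies in `𝒪`. -/
theorem mem_setO_of_mem_curveC {v : Fin 4 → F} (hv : v ≠ 0)
    {hv' : algebraMap F (AlgebraicClosure F) ∘ v ≠ 0}
    (h : (.mk _ (algebraMap F (AlgebraicClosure F) ∘ v) hv' : PG3 (AlgebraicClosure F)) ∈
      curveC F q) :
    (.mk F v hv : PG3 F) ∈ setO F q := by
  have inj := (algebraMap F (AlgebraicClosure F)).injective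
  rcases h with ⟨t, h⟩ | h
  · left
    obtain ⟨c, hc⟩ := (Projectivization.mk_eq_mk_iff' _ _ _ _ _).1 h
    have h0 := congrFun hc 0
    have h1 := congrFun hc 1
    have h2 := congrFun hc 2
    have h3 := congrFun hc 3
    simp at h0 h1 h2 h3
    have hv0 : v 0 ≠ 0 := by
      intro h
      rw [h, map_zero] at h0
      apply hv
      ext i
      simp only [h0, zero_mul] at h1 h2 h3
      fin_cases i
      · exact h
      · exact inj (by simp [← h1])
      · exact inj (by simp [← h2])
      · exact inj (by simp [← h3])
    have hv0' : algebraMap F (AlgebraicClosure F) (v 0) ≠ 0 := by simpa using hv0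
    have ht : t = algebraMap F (AlgebraicClosure F) (v 1 / v 0) := by
      rw [map_div₀, eq_div_iff hv0', ← h1, h0, mul_comm]
    rw [h0, ht] at h1 h2 h3
    refine ⟨v 1 / v 0, (Projectivization.mk_eq_mk_iff' _ _ _ _ _).2 ⟨v 0, ?_⟩⟩
    ext i
    apply inj
    fin_cases i
    · simp
    · simpa using h1
    · simpa using h2
    · simpa using h3
  · right
    rw [Set.mem_singleton_iff] at h ⊢
    obtain ⟨c, hc⟩ := (Projectivization.mk_eq_mk_iff' _ _ _ _ _).1 h
    have h0 := congrFun hc 0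
    have h1 := congrFun hc 1
    have h2 := congrFun hc 2
    simp at h0 h1 h2
    rw [eq_comm, map_eq_zero] at h0 h1 h2
    refine (Projectivization.mk_eq_mk_iff' _ _ _ _ _).2 ⟨v 3, ?_⟩
    ext i
    fin_cases i <;> simp [h0, h1, h2]

theorem comp_algebraMap_ne_zero {v : Fin 4 → F} (hv : v ≠ 0) :
    algebraMap F (AlgebraicClosure F) ∘ v ≠ 0 := by
  contrapose! hv
  ext i
  simpa using congrFun hv i

theorem mem_curveC_of_mem_setO {v : Fin 4 → F} (hv : v ≠ 0)
    (h : (.mk F v hv : PG3 F) ∈ setO F q) :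
    (.mk _ (algebraMap F (AlgebraicClosure F) ∘ v) (comp_algebraMap_ne_zero hv) :
      PG3 (AlgebraicClosure F)) ∈ curveC F q := by
  rcases h with ⟨t, h⟩ | h
  · left
    obtain ⟨c, rfl⟩ := (Projectivization.mk_eq_mk_iff' _ _ _ _ _).1 h
    refine ⟨algebraMap F _ t, (Projectivization.mk_eq_mk_iff' _ _ _ _ _).2 ⟨algebraMap F _ c, ?_⟩⟩
    ext i
    fin_cases i <;> simp
  · right
    obtain ⟨c, rfl⟩ := (Projectivization.mk_eq_mk_iff' _ _ _ _ _).1 h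
    refine (Projectivization.mk_eq_mk_iff' _ _ _ _ _).2 ⟨algebraMap F _ c, ?_⟩
    ext i
    fin_cases i <;> simp

theorem groupG_le_groupG' : groupG F q ≤ groupG' F q := by
  apply mem_stabilizer_of_smul_mem
  intro g hg P hP
  induction g using Matrix.ProjGenLinGroup.induction_on with | mk M =>
  induction P using Projectivization.ind with | h v hv =>
  have := (MulAction.mem_stabilizer_set.1 hg _).2 (mem_curveC_of_mem_setO hv hP)
  rw [mk_smul_mk M hv (mulVec_ne_zero M hv) rfl]
  apply mem_setO_of_mem_curveC (hv' := comp_algebraMap_ne_zero (mulVec_ne_zero M hv))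
  rw [Matrix.ProjGenLinGroup.map_mk, mk_smul_mk _ _
    (comp_algebraMap_ne_zero (mulVec_ne_zero M hv))] at this
  · exact this
  · ext i
    simp [Matrix.mulVec, dotProduct]

theorem range_frobPGL_le_groupG [Fintype F] (hF : Fintype.card F = q ^ 2) :
    (frobPGL hq0 hadd).range ≤ groupG F q := by
  rintro _ ⟨g, rfl⟩
  induction g using Matrix.ProjGenLinGroup.induction_on with | mk A =>
  have hadd' := add_pow_of_card (L := AlgebraicClosure F) hF
  apply range_frobPGL_le_stabilizer hq0 hadd'
  refine ⟨.mk (Matrix.GeneralLinearGroup.map (algebraMap F (AlgebraicClosure F)) A), ?_⟩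
  rw [frobPGL_mk, frobPGL_mk, Matrix.ProjGenLinGroup.map_mk]
  congr 1
  apply Units.ext
  rw [coe_frobGL]
  ext i j
  rw [Matrix.GeneralLinearGroup.map_apply, coe_frobGL]
  fin_cases i <;> fin_cases j <;> simp [frobTensor]

/-- The image (1, t^q, t, t^(q+1)) of a curve point lies on 𝒞 only if its parameter is s = t^q with
s^q = t. This cannot hold for every t in an infinite field. -/
theorem iota_notMem_groupG (hq3 : 3 ≤ q) : iota F ∉ groupG F q := by
  intro h
  have hinf : Infinite (AlgebraicClosure F) := IsAlgClosed.instInfinite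
  have key (t : AlgebraicClosure F) : t ^ (q * q) = t := by
    have := (MulAction.mem_stabilizer_set.1 h
      (.mk _ ![1, t, t ^ q, t ^ (q + 1)] (vec_one_ne_zero _ _ _ _))).2 (Or.inl ⟨t, rfl⟩)
    rw [iota, Matrix.ProjGenLinGroup.map_mk, mk_smul_mk (w := ![1, t ^ q, t, t ^ (q + 1)]) _ _
      (vec_one_ne_zero _ _ _ _)] at this
    · rcases this with ⟨s, hs⟩ | hs
      · obtain ⟨c, hc⟩ := (Projectivization.mk_eq_mk_iff' _ _ _ _ _).1 hs
        have h0 := congrFun hc 0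
        have h1 := congrFun hc 1
        have h2 := congrFun hc 2
        simp at h0 h1 h2
        subst h0
        rw [pow_mul, ← h1, ← h2, one_mul, one_mul]
      · obtain ⟨c, hc⟩ := (Projectivization.mk_eq_mk_iff' _ _ _ _ _).1 hs
        simpa using congrFun hc 0
    · ext i
      fin_cases i <;> simp [Matrix.mulVec, dotProduct, Fin.sum_univ_four]
  have hp : (Polynomial.X ^ (q * q) - Polynomial.X : Polynomial (AlgebraicClosure F)) = 0 := by
    apply Polynomial.funext
    intro t
    simp [key t]
  have := congrArg (fun p => p.coeff 1) hp
  simp [Polynomial.coeff_X_pow, show 1 ≠ q * q by nlinarith] at this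

/-- If g ∈ G were in the coset Rι of the range R, then ι would lie in G, since R ≤ G. -/
theorem groupG_eq_range (hq3 : 3 ≤ q) [Fintype F] (hF : Fintype.card F = q ^ 2) :
    groupG F q = (frobPGL hq0 hadd).range := by
  have hle := range_frobPGL_le_groupG hq0 hadd hF
  refine le_antisymm (fun g hg => ?_) hle
  rcases mem_range_or_mul_iota_mem_range hq0 hadd hq3 hF (groupG_le_groupG' hg) with h | h
  · exact h
  · exact absurd (by simpa using mul_mem (inv_mem hg) (hle h)) (iota_notMem_groupG (F := F) hq3)

theorem nonempty_groupG_mulEquiv (hq3 : 3 ≤ q) [Fintype F] (hF : Fintype.card F = q ^ 2) :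
    Nonempty (groupG F q ≃* PGL(2, F)) := by
  have hq0 : q ≠ 0 := by omega
  have hadd := add_pow_of_card (L := F) hF
  exact ⟨((MonoidHom.ofInjective (frobPGL_injective hq0 hadd)).trans
    (MulEquiv.subgroupCongr (groupG_eq_range hq0 hadd hq3 hF).symm)).symm⟩

theorem mem_groupG_or_mul_iota_mem (hq3 : 3 ≤ q) [Fintype F] (hF : Fintype.card F = q ^ 2) {g : PGL(4, F)}
    (hg : g ∈ groupG' F q) : g ∈ groupG F q ∨ g * iota F ∈ groupG F q := by
  have hq0 : q ≠ 0 := by omega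
  have hadd := add_pow_of_card (L := F) hF
  rw [groupG_eq_range hq0 hadd hq3 hF]
  exact mem_range_or_mul_iota_mem_range hq0 hadd hq3 hF hg

theorem groupG_subgroupOf_normal (hq3 : 3 ≤ q) [Fintype F] (hF : Fintype.card F = q ^ 2) :
    ((groupG F q).subgroupOf (groupG' F q)).Normal := by
  apply Subgroup.normal_of_index_eq_two
  rw [Subgroup.index_eq_two_iff]
  refine ⟨⟨iota F, iota_mem_groupG' (by omega) hF⟩, fun b => ?_⟩
  simp only [Subgroup.mem_subgroupOf, Subgroup.coe_mul]
  by_cases hb : b.1 ∈ groupG F q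
  · refine Or.inr ⟨hb, fun h => iota_notMem_groupG (F := F) hq3 ?_⟩
    simpa using mul_mem (inv_mem hb) h
  · exact Or.inl ⟨(mem_groupG_or_mul_iota_mem hq3 hF b.2).resolve_left hb, hb⟩

theorem groupG_inf_zpowers_iota (hq3 : 3 ≤ q) :
    groupG F q ⊓ Subgroup.zpowers (iota F) = ⊥ := by
  rw [eq_bot_iff]
  rintro g ⟨hg, hg'⟩
  rcases mem_zpowers_iota.1 hg' with rfl | rfl
  · exact one_mem _
  · exact absurd hg (iota_notMem_groupG hq3)

theorem groupG_sup_zpowers_iota (hq3 : 3 ≤ q) [Fintype F] (hF : Fintype.card F = q ^ 2) :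
    groupG F q ⊔ Subgroup.zpowers (iota F) = groupG' F q := by
  apply le_antisymm
  · rw [sup_le_iff, Subgroup.zpowers_le]
    exact ⟨groupG_le_groupG', iota_mem_groupG' (by omega) hF⟩
  · intro g hg
    rcases mem_groupG_or_mul_iota_mem hq3 hF hg with h | h
    · exact Subgroup.mem_sup_left h
    · have := mul_mem (Subgroup.mem_sup_left (T := Subgroup.zpowers (iota F)) h)
        (Subgroup.mem_sup_right (Subgroup.mem_zpowers _))
      rwa [mul_assoc, iota_mul_iota, mul_one] at this

end Groups

/-! ### Congruence of sesquilinear forms; the rank-one case -/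

section Rel

variable {F : Type*} [Field F] {q : ℕ}

/-- Two vectors are related if some `A^q ⊗ A` maps the first to a multiple of the second. -/
def Rel (q : ℕ) (v w : Fin 4 → F) : Prop :=
  ∃ A : Matrix (Fin 2) (Fin 2) F, A.det ≠ 0 ∧ ∃ c : F, c ≠ 0 ∧ (frobTensor q A).mulVec v = c • w

theorem sub_pow_of_add_pow (hadd : ∀ x y : F, (x + y) ^ q = x ^ q + y ^ q) (x y : F) :
    (x - y) ^ q = x ^ q - y ^ q := by
  rw [eq_sub_iff_add_eq, ← hadd, sub_add_cancel]

theorem Rel.trans (hadd : ∀ x y : F, (x + y) ^ q = x ^ q + y ^ q) {u v w : Fin 4 → F}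
    (h : Rel q u v) (h' : Rel q v w) : Rel q u w := by
  obtain ⟨A, hA, c, hc, h⟩ := h
  obtain ⟨B, hB, d, hd, h'⟩ := h'
  refine ⟨B * A, by rw [Matrix.det_mul]; exact mul_ne_zero hB hA, c * d, mul_ne_zero hc hd, ?_⟩
  rw [frobTensor_mul hadd, ← Matrix.mulVec_mulVec, h, Matrix.mulVec_smul, h', smul_smul]

theorem Rel.symm (hq0 : q ≠ 0) (hadd : ∀ x y : F, (x + y) ^ q = x ^ q + y ^ q)
    {v w : Fin 4 → F} (h : Rel q v w) : Rel q w v := by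
  obtain ⟨A, hA, c, hc, h⟩ := h
  have hu : IsUnit A.det := isUnit_iff_ne_zero.2 hA
  refine ⟨A⁻¹, (Matrix.isUnit_nonsing_inv_det A hu).ne_zero, c⁻¹, inv_ne_zero hc, ?_⟩
  rw [← one_smul F w, ← inv_mul_cancel₀ hc, mul_smul, ← h, Matrix.mulVec_smul,
    Matrix.mulVec_mulVec, ← frobTensor_mul hadd, Matrix.nonsing_inv_mul A hu, frobTensor_one hq0,
    Matrix.one_mulVec]

theorem rel_of_eq (a b c d k : F) {v w : Fin 4 → F} (hdet : a * d - b * c ≠ 0) (hk : k ≠ 0)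
    (h0 : a ^ q * (a * v 0 + b * v 1) + b ^ q * (a * v 2 + b * v 3) = k * w 0)
    (h1 : a ^ q * (c * v 0 + d * v 1) + b ^ q * (c * v 2 + d * v 3) = k * w 1)
    (h2 : c ^ q * (a * v 0 + b * v 1) + d ^ q * (a * v 2 + b * v 3) = k * w 2)
    (h3 : c ^ q * (c * v 0 + d * v 1) + d ^ q * (c * v 2 + d * v 3) = k * w 3) : Rel q v w := by
  refine ⟨!![a, b; c, d], by rwa [Matrix.det_fin_two_of], k, hk, ?_⟩
  rw [frobTensor_mulVec]
  ext i
  fin_cases i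
  · simpa using h0
  · simpa using h1
  · simpa using h2
  · simpa using h3

theorem rel_smul (hq0 : q ≠ 0) {c : F} (hc : c ≠ 0) (v : Fin 4 → F) : Rel q (c • v) v :=
  ⟨1, by simp, c, hc, by rw [frobTensor_one hq0, Matrix.one_mulVec]⟩

/-- Determinant of A^(q) V Aᵀ. -/
theorem quadForm_frobTensor (hadd : ∀ x y : F, (x + y) ^ q = x ^ q + y ^ q)
    (A : Matrix (Fin 2) (Fin 2) F) (v : Fin 4 → F) :
    quadForm ((frobTensor q A).mulVec v) = A.det ^ (q + 1) * quadForm v := by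
  rw [frobTensor_mulVec, Matrix.det_fin_two, pow_succ, sub_pow_of_add_pow hadd]
  simp [quadForm, mul_pow]
  ring

/-- As the q²-power map is trivial, V* also becomes A^(q) V* Aᵀ. The whole pencil det(V - lV*) is
therefore scaled by the same factor, and h is its middle coefficient. -/
theorem hermForm_frobTensor (hadd : ∀ x y : F, (x + y) ^ q = x ^ q + y ^ q)
    (hqq : ∀ x : F, (x ^ q) ^ q = x) (A : Matrix (Fin 2) (Fin 2) F) (v : Fin 4 → F) :
    hermForm q ((frobTensor q A).mulVec v) = A.det ^ (q + 1) * hermForm q v := by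
  rw [frobTensor_mulVec, Matrix.det_fin_two, pow_succ, sub_pow_of_add_pow hadd]
  simp [hermForm, mul_pow, pow_succ, hadd, hqq]
  ring

theorem quadForm_smul (c : F) (v : Fin 4 → F) : quadForm (c • v) = c ^ 2 * quadForm v := by
  simp [quadForm]
  ring

theorem hermForm_smul (c : F) (v : Fin 4 → F) :
    hermForm q (c • v) = c ^ (q + 1) * hermForm q v := by
  simp [hermForm, mul_pow]
  ring

theorem hermForm_pow (hadd : ∀ x y : F, (x + y) ^ q = x ^ q + y ^ q)
    (hqq : ∀ x : F, (x ^ q) ^ q = x) (v : Fin 4 → F) : hermForm q v ^ q = hermForm q v := by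
  simp [hermForm, sub_pow_of_add_pow hadd, hadd, mul_pow, pow_succ, hqq]
  ring

theorem rel_diag_mul (hq0 : q ≠ 0) (x : F) {a : F} (ha : a ≠ 0) :
    Rel q ![x, 0, 0, 1] ![a ^ (q + 1) * x, 0, 0, 1] := by
  refine rel_of_eq a 0 0 1 1 (by simpa) one_ne_zero ?_ ?_ ?_ ?_ <;> simp [hq0]
  ring

theorem rel_diag_inv (hq0 : q ≠ 0) {x : F} (hx : x ≠ 0) :
    Rel q ![x, 0, 0, 1] ![x⁻¹, 0, 0, 1] := by
  refine rel_of_eq 0 1 1 0 x (by simp) hx ?_ ?_ ?_ ?_ <;> simp [hq0, hx]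

theorem rel_antidiag_mul (hq0 : q ≠ 0) (x : F) {a : F} (ha : a ≠ 0) :
    Rel q ![0, x, 1, 0] ![0, a ^ (q - 1) * x, 1, 0] := by
  obtain ⟨n, rfl⟩ := Nat.exists_eq_succ_of_ne_zero hq0
  refine rel_of_eq a 0 0 1 a (by simpa) ha ?_ ?_ ?_ ?_ <;> simp
  ring

theorem rel_antidiag_inv (hq0 : q ≠ 0) {x : F} (hx : x ≠ 0) :
    Rel q ![0, x, 1, 0] ![0, x⁻¹, 1, 0] := by
  refine rel_of_eq 0 1 1 0 x (by simp) hx ?_ ?_ ?_ ?_ <;> simp [hq0, hx]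

theorem rel_antidiag_shift (hq0 : q ≠ 0) (y w s : F) :
    Rel q ![0, y, 1, w] ![0, y, 1, s ^ q * y + s + w] := by
  refine rel_of_eq 1 0 s 1 1 (by simp) one_ne_zero ?_ ?_ ?_ ?_ <;> simp [hq0]
  ring

/-- A vector of rank one is related to `(1, 0, 0, 0)` or to `(0, 1, 0, 0)`. -/
theorem rel_of_quadForm_eq_zero (hq0 : q ≠ 0) (hadd : ∀ x y : F, (x + y) ^ q = x ^ q + y ^ q)
    (hqq : ∀ x : F, (x ^ q) ^ q = x) {v : Fin 4 → F} (hv : v ≠ 0) (h : quadForm v = 0) :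
    Rel q v ![1, 0, 0, 0] ∨ Rel q v ![0, 1, 0, 0] := by
  -- A rank-one matrix is an outer product x^(q) yᵀ. If x and y are proportional the form is
  -- Hermitian up to a scalar; otherwise they can serve as a basis.
  obtain ⟨x₀, x₁, y₀, y₁, hxy⟩ : ∃ x₀ x₁ y₀ y₁ : F,
      v = ![x₀ ^ q * y₀, x₀ ^ q * y₁, x₁ ^ q * y₀, x₁ ^ q * y₁] := by
    rw [quadForm, sub_eq_zero] at h
    by_cases h0 : v 0 = 0
    · by_cases h1 : v 1 = 0
      · refine ⟨0, 1, v 2, v 3, ?_⟩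
        ext i
        fin_cases i <;> simp [h0, h1, hq0]
      · refine ⟨1, (v 3 / v 1) ^ q, v 0, v 1, ?_⟩
        have h2 : v 2 = 0 := by simpa [h0, h1] using h
        rw [hqq]
        ext i
        fin_cases i <;> simp [h0, h1, h2]
    · refine ⟨1, (v 2 / v 0) ^ q, v 0, v 1, ?_⟩
      rw [hqq]
      ext i
      fin_cases i
      · simp
      · simp
      · simp [h0]
      · simp
        field_simp
        linear_combination h
  have hx : ¬(x₀ = 0 ∧ x₁ = 0) := by
    rintro ⟨rfl, rfl⟩
    apply hv
    rw [hxy]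
    ext i
    fin_cases i <;> simp [hq0]
  have hy : ¬(y₀ = 0 ∧ y₁ = 0) := by
    rintro ⟨rfl, rfl⟩
    apply hv
    rw [hxy]
    ext i
    fin_cases i <;> simp
  by_cases hd : x₀ * y₁ - y₀ * x₁ = 0
  · left
    apply Rel.symm hq0 hadd
    obtain ⟨k, hk, hy₀, hy₁⟩ : ∃ k : F, k ≠ 0 ∧ x₀ = k * y₀ ∧ x₁ = k * y₁ := by
      by_cases h0 : y₀ = 0
      · have h1 : y₁ ≠ 0 := fun h1 => hy ⟨h0, h1⟩
        have hx0 : x₀ = 0 := by simpa [h0, h1] using hd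
        refine ⟨x₁ / y₁, div_ne_zero (fun h => hx ⟨hx0, h⟩) h1, by simp [hx0, h0], by field_simp⟩
      · have hx1 : x₁ = x₀ / y₀ * y₁ := by field_simp; linear_combination -hd
        refine ⟨x₀ / y₀, div_ne_zero (fun h => hx ⟨h, by rw [hx1, h]; simp⟩) h0,
          by field_simp, hx1⟩
    by_cases h0 : x₀ = 0
    · refine rel_of_eq x₀ 1 x₁ 0 k (by simpa using fun h => hx ⟨h0, h⟩) hk ?_ ?_ ?_ ?_ <;>
        simp [hxy] <;> simp only [hy₀, hy₁] <;> ring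
    · refine rel_of_eq x₀ 0 x₁ 1 k (by simpa) hk ?_ ?_ ?_ ?_ <;>
        simp [hxy] <;> simp only [hy₀, hy₁] <;> ring
  · right
    apply Rel.symm hq0 hadd
    refine rel_of_eq x₀ y₀ x₁ y₁ 1 hd one_ne_zero ?_ ?_ ?_ ?_ <;> simp [hxy]

end Rel

/-! ### Rank two: splitting by the pencil V - lV* -/

section Finite

variable {F : Type*} [Field F] [Fintype F] {q : ℕ}

/-- Elements of F_q are squares in F_{q²}: Euler's criterion applies since (q² - 1)/2 is a multiple
of q - 1. -/
theorem exists_sq_eq_of_pow_eq (hq : Odd q) (hF : Fintype.card F = q ^ 2) {x : F}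
    (hx : x ^ q = x) : ∃ s : F, s ^ 2 = x := by
  rcases eq_or_ne x 0 with rfl | hx0
  · exact ⟨0, by simp⟩
  obtain ⟨k, rfl⟩ := hq
  have h1 : x ^ (2 * k) = 1 := by
    rw [pow_succ] at hx
    exact mul_right_cancel₀ hx0 (by rw [hx, one_mul])
  have hch : ringChar F ≠ 2 := by
    intro h
    have h' := FiniteField.even_card_iff_char_two.1 h
    rw [hF] at h'
    have := Nat.odd_iff.1 ((odd_two_mul_add_one k).pow (n := 2))
    omega
  obtain ⟨s, hs⟩ := (FiniteField.isSquare_iff hch hx0).2 (by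
    have : Fintype.card F / 2 = 2 * k * (k + 1) := by
      rw [hF, show (2 * k + 1) ^ 2 = 2 * (2 * k * (k + 1)) + 1 by ring]
      omega
    rw [this, pow_mul, h1, one_pow])
  exact ⟨s, by rw [hs, sq]⟩

theorem exists_pow_mul_eq {ξ x : F} {n m : ℕ} (hξ : IsPrimitiveRoot ξ (n * m))
    (hF : Fintype.card F = n * m + 1) (hx : x ^ n = 1) : ∃ j : ℕ, x = ξ ^ (m * j) := by
  have hnm : n * m ≠ 0 := by
    have : 1 < Fintype.card F := Fintype.one_lt_card
    omega
  have := NeZero.mk hnm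
  obtain ⟨i, -, rfl⟩ := hξ.eq_pow_of_pow_eq_one (ξ := x) (by rw [pow_mul, hx, one_pow])
  rw [← pow_mul, hξ.pow_eq_one_iff_dvd, mul_comm] at hx
  obtain ⟨j, rfl⟩ := Nat.dvd_of_mul_dvd_mul_right (Nat.pos_of_ne_zero (left_ne_zero_of_mul hnm)) hx
  exact ⟨j, rfl⟩

theorem exists_pow_eq_of_ne_zero {ξ x : F} {n : ℕ} (hξ : IsPrimitiveRoot ξ n)
    (hF : Fintype.card F = n + 1) (hx : x ≠ 0) : ∃ j : ℕ, x = ξ ^ j := by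
  obtain ⟨j, hj⟩ := exists_pow_mul_eq (n := n) (m := 1) (x := x) (by simpa) (by simpa) (by
    have := FiniteField.pow_card_sub_one_eq_one x hx
    rwa [hF, Nat.add_sub_cancel] at this)
  exact ⟨j, by simpa using hj⟩

/-- A vector of rank two is related to one in diagonal form or with first coordinate zero. -/
theorem exists_rel_of_quadForm_ne_zero (hq : Odd q) (hF : Fintype.card F = q ^ 2)
    {v : Fin 4 → F} (h : quadForm v ≠ 0) :
    (∃ x, x ≠ 0 ∧ Rel q v ![x, 0, 0, 1]) ∨ ∃ y w, y ≠ 0 ∧ Rel q v ![0, y, 1, w] := by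
  have hq0 : q ≠ 0 := by rintro rfl; simp at hq
  have hadd := add_pow_of_card (L := F) hF
  have hqq := pow_pow_of_card (F := F) hF
  have h2 := two_ne_zero_of_card hq hF
  -- The discriminant of D - l h + l² D^q is fixed by the q-power map, so its square root s yields
  -- the root l below.
  obtain ⟨s, hs⟩ := exists_sq_eq_of_pow_eq (x := hermForm q v ^ 2 - 4 * quadForm v ^ (q + 1))
    hq hF (by
      have h4 : (4 : F) ^ q = 4 := by
        have : (2 : F) ^ q = 2 := by
          rw [← one_add_one_eq_two, hadd, one_pow]
        rw [show (4 : F) = 2 * 2 by norm_num, mul_pow, this]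
      rw [sub_pow_of_add_pow hadd, mul_pow, h4, pow_succ (quadForm v), mul_pow, hqq, ← pow_mul,
        mul_comm 2 q, pow_mul, hermForm_pow hadd hqq]
      ring)
  set D := quadForm v with hD
  set H := hermForm q v with hH
  have hDq : D ^ q ≠ 0 := pow_ne_zero q h
  set l := (H + s) / (2 * D ^ q) with hl
  have hl2 : D - l * H + l ^ 2 * D ^ q = 0 := by
    have e : l * (2 * D ^ q) = H + s := by rw [hl]; field_simp
    have : 4 * D ^ q * (D - l * H + l ^ 2 * D ^ q) = 0 := by
      have e2 : s ^ 2 = (l * (2 * D ^ q) - H) ^ 2 := by rw [e]; ring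
      rw [hs, pow_succ] at e2
      linear_combination -e2
    have h4 : (4 : F) ≠ 0 := by rw [show (4 : F) = 2 * 2 by norm_num]; exact mul_ne_zero h2 h2
    exact (mul_eq_zero.1 this).resolve_left (mul_ne_zero h4 hDq)
  -- N = V - lV*, singular by the choice of l.
  let N : Matrix (Fin 2) (Fin 2) F :=
    !![v 0 - l * v 0 ^ q, v 1 - l * v 2 ^ q; v 2 - l * v 1 ^ q, v 3 - l * v 3 ^ q]
  have hN : N.det = 0 := by
    rw [Matrix.det_fin_two_of, ← hl2, hD, hH, quadForm, hermForm, sub_pow_of_add_pow hadd]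
    ring
  obtain ⟨b, hb, hNb⟩ := Matrix.exists_mulVec_eq_zero_iff.2 hN
  have n0 := congrFun hNb 0
  have n1 := congrFun hNb 1
  simp [N, Matrix.mulVec, dotProduct] at n0 n1
  set f0 := b 0 ^ q * v 0 + b 1 ^ q * v 2 with hf0
  set f1 := b 0 ^ q * v 1 + b 1 ^ q * v 3 with hf1
  have hdet : ∀ A : Matrix (Fin 2) (Fin 2) F, A.det ≠ 0 →
      quadForm ((frobTensor q A).mulVec v) ≠ 0 := fun A hA => by
    rw [quadForm_frobTensor hadd]
    exact mul_ne_zero (pow_ne_zero _ hA) h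
  -- The value of the form at the kernel vector b. If it is zero, any basis starting with b makes
  -- the first coordinate vanish.
  by_cases hbb : f0 * b 0 + f1 * b 1 = 0
  · right
    obtain ⟨c, hc⟩ : ∃ c : Fin 2 → F, b 0 * c 1 - b 1 * c 0 ≠ 0 := by
      by_cases h0 : b 0 = 0
      · refine ⟨![1, 0], ?_⟩
        simp
        rintro h1
        apply hb
        ext i
        fin_cases i <;> simp [h0, h1]
      · exact ⟨![0, 1], by simpa⟩
    have hq' := hdet !![b 0, b 1; c 0, c 1] (by rwa [Matrix.det_fin_two_of])
    set w := (frobTensor q !![b 0, b 1; c 0, c 1]).mulVec v with hw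
    have hw0 : w 0 = 0 := by
      rw [hw, frobTensor_mulVec]
      simp
      linear_combination hbb
    rw [quadForm, hw0, zero_mul, zero_sub, neg_ne_zero, mul_ne_zero_iff] at hq'
    refine ⟨w 1 / w 2, w 3 / w 2, div_ne_zero hq'.1 hq'.2, !![b 0, b 1; c 0, c 1],
      by rwa [Matrix.det_fin_two_of], w 2, hq'.2, ?_⟩
    rw [← hw]
    ext i
    fin_cases i
    · simpa using hw0
    · simp [mul_div_cancel₀ _ hq'.2]
    · simp
    · simp [mul_div_cancel₀ _ hq'.2]
  · left
    -- The second row spans the right orthogonal of b, and the determinant is the value of the form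
    -- at b.
    have hdet' : (!![b 0, b 1; -f1, f0] : Matrix (Fin 2) (Fin 2) F).det ≠ 0 := by
      rw [Matrix.det_fin_two_of]
      contrapose! hbb
      linear_combination hbb
    have hq' := hdet _ hdet'
    set w := (frobTensor q !![b 0, b 1; -f1, f0]).mulVec v with hw
    have hw1 : w 1 = 0 := by
      rw [hw, frobTensor_mulVec]
      simp
      linear_combination f1 * hf0 - f0 * hf1
    -- Vb = lV*b ties left orthogonality to right orthogonality, so both off-diagonal entries
    -- vanish.
    have hw2 : w 2 = l * w 1 ^ q := by
      rw [hw, frobTensor_mulVec]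
      simp [hadd, mul_pow, hqq, hq.neg_pow]
      linear_combination -f1 ^ q * n0 + f0 ^ q * n1
    rw [hw1, zero_pow hq0, mul_zero] at hw2
    rw [quadForm, hw1, zero_mul, sub_zero, mul_ne_zero_iff] at hq'
    refine ⟨w 0 / w 3, div_ne_zero hq'.1 hq'.2, _, hdet', w 3, hq'.2, ?_⟩
    rw [← hw]
    ext i
    fin_cases i
    · simp [mul_div_cancel₀ _ hq'.2]
    · simpa using hw1
    · simpa using hw2
    · simp

end Finite

/-! ### Reduction of the parameters to normal forms -/

section NormalForm

variable {F : Type*} [Field F] [Fintype F] {q : ℕ} {ξ : F}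

theorem sq_sub_one_eq (hq : Odd q) : q ^ 2 - 1 = (q - 1) * (q + 1) := by
  obtain ⟨m, rfl⟩ := hq
  rw [show (2 * m + 1) ^ 2 = (2 * m) * (2 * m + 1 + 1) + 1 by ring]
  simp

theorem card_eq_mul_add_one {F : Type*} [Fintype F] (hq : Odd q) (hF : Fintype.card F = q ^ 2) :
    Fintype.card F = (q - 1) * (q + 1) + 1 := by
  obtain ⟨m, rfl⟩ := hq
  rw [hF]
  simp
  ring

/-- Surjectivity of the norm onto F_q^×, read off from powers of ξ. -/
theorem exists_pow_add_one_eq (hq : Odd q) (hF : Fintype.card F = q ^ 2)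
    (hξ : IsPrimitiveRoot ξ (q ^ 2 - 1)) {x : F} (hx0 : x ≠ 0) (hx : x ^ q = x) :
    ∃ a : F, a ≠ 0 ∧ a ^ (q + 1) = x := by
  rw [sq_sub_one_eq hq] at hξ
  obtain ⟨j, rfl⟩ := exists_pow_mul_eq hξ (card_eq_mul_add_one hq hF) (x := x) (by
    obtain ⟨m, rfl⟩ := hq
    rw [pow_succ] at hx
    exact mul_right_cancel₀ hx0 (by simp [hx]))
  refine ⟨ξ ^ j, fun h => hx0 ?_, by rw [← pow_mul, mul_comm]⟩
  rw [mul_comm, pow_mul, h, zero_pow (by omega)]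

/-- Hilbert 90 for F_{q²} over F_q. -/
theorem exists_pow_sub_one_eq (hq : Odd q) (hF : Fintype.card F = q ^ 2)
    (hξ : IsPrimitiveRoot ξ (q ^ 2 - 1)) {x : F} (hx : x ^ (q + 1) = 1) :
    ∃ a : F, a ≠ 0 ∧ a ^ (q - 1) = x := by
  have h3 := three_le_of_card hq hF
  rw [sq_sub_one_eq hq, mul_comm] at hξ
  obtain ⟨j, rfl⟩ := exists_pow_mul_eq hξ
    (by rw [card_eq_mul_add_one hq hF, mul_comm]) hx
  refine ⟨ξ ^ j, fun h => ?_, by rw [← pow_mul, mul_comm]⟩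
  rw [mul_comm, pow_mul, h, zero_pow (by omega), zero_pow (by omega)] at hx
  exact zero_ne_one hx

theorem ne_zero_of_isPrimitiveRoot (hq : Odd q) (hF : Fintype.card F = q ^ 2)
    (hξ : IsPrimitiveRoot ξ (q ^ 2 - 1)) : ξ ≠ 0 := by
  have h3 := three_le_of_card hq hF
  exact hξ.ne_zero (by rw [sq_sub_one_eq hq]; exact mul_ne_zero (by omega) (by omega))

theorem pow_half_eq_neg_one (hq : Odd q) (hF : Fintype.card F = q ^ 2)
    (hξ : IsPrimitiveRoot ξ (q ^ 2 - 1)) : ξ ^ ((q - 1) * ((q + 1) / 2)) = -1 := by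
  have h3 := three_le_of_card hq hF
  rw [sq_sub_one_eq hq] at hξ
  have h2 : (q + 1) / 2 * 2 = q + 1 := Nat.div_mul_cancel (by
    obtain ⟨m, rfl⟩ := hq
    exact ⟨m + 1, by ring⟩)
  have h1 : (ξ ^ ((q - 1) * ((q + 1) / 2))) ^ 2 = 1 ^ 2 := by
    rw [← pow_mul, mul_assoc, h2, hξ.pow_eq_one, one_pow]
  refine (eq_or_eq_neg_of_sq_eq_sq _ _ h1).resolve_left ?_
  · rw [hξ.pow_eq_one_iff_dvd]
    intro h
    have := Nat.le_of_dvd (Nat.mul_pos (by omega) (by omega)) h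
    have := Nat.le_of_mul_le_mul_left this (by omega)
    omega

theorem pow_half_pow (hq : Odd q) (hF : Fintype.card F = q ^ 2)
    (hξ : IsPrimitiveRoot ξ (q ^ 2 - 1)) : (ξ ^ ((q + 1) / 2)) ^ q = -ξ ^ ((q + 1) / 2) := by
  have h := pow_half_eq_neg_one hq hF hξ
  obtain ⟨m, rfl⟩ := hq
  rw [pow_succ, ← pow_mul, mul_comm _ (2 * m)]
  simp at h ⊢
  rw [h, neg_one_mul]

/-- With s^(q+1) = -1, the vectors (1, s) and (1, -s) form a hyperbolic pair, up to the scalar 2,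
for the identity Hermitian form. -/
theorem rel_diag_one (hq : Odd q) (hF : Fintype.card F = q ^ 2)
    (hξ : IsPrimitiveRoot ξ (q ^ 2 - 1)) : Rel q (![1, 0, 0, 1] : Fin 4 → F) ![0, 1, 1, 0] := by
  have h2 := two_ne_zero_of_card hq hF
  obtain ⟨s, hs0, hs⟩ := exists_pow_add_one_eq hq hF hξ (x := -1) (by simp) (by simp [hq.neg_pow])
  rw [pow_succ] at hs
  refine rel_of_eq 1 s 1 (-s) 2 ?_ h2 ?_ ?_ ?_ ?_
  · rw [show 1 * -s - s * 1 = -(2 * s) by ring]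
    exact neg_ne_zero.2 (mul_ne_zero h2 hs0)
  · simp [hs]
  · simp [hs]
    norm_num
  · simp [hq.neg_pow, hs]
    norm_num
  · simp [hq.neg_pow, hs]

theorem rel_diag_cases (hq : Odd q) (hF : Fintype.card F = q ^ 2)
    (hξ : IsPrimitiveRoot ξ (q ^ 2 - 1)) {x : F} (hx : x ≠ 0) :
    Rel q ![x, 0, 0, 1] ![0, 1, 1, 0] ∨
      ∃ j, 1 ≤ j ∧ j ≤ (q + 1) / 2 ∧ Rel q ![x, 0, 0, 1] ![ξ ^ j, 0, 0, 1] := by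
  have hq0 : q ≠ 0 := by rintro rfl; simp at hq
  have hadd := add_pow_of_card (L := F) hF
  have hξ0 := ne_zero_of_isPrimitiveRoot hq hF hξ
  have hξ' := sq_sub_one_eq hq ▸ hξ
  obtain ⟨j, rfl⟩ := exists_pow_eq_of_ne_zero hξ' (card_eq_mul_add_one hq hF) hx
  have e : ξ ^ j = (ξ ^ (j / (q + 1))) ^ (q + 1) * ξ ^ (j % (q + 1)) := by
    rw [← pow_mul, ← pow_add, mul_comm, Nat.div_add_mod]
  have h1 := (rel_diag_mul hq0 (ξ ^ (j % (q + 1))) (pow_ne_zero (j / (q + 1)) hξ0)).symm hq0 hadd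
  rw [← e] at h1
  have hlt : j % (q + 1) < q + 1 := Nat.mod_lt _ (by omega)
  generalize j % (q + 1) = r at h1 hlt
  rcases Nat.eq_zero_or_pos r with rfl | hr
  · left
    rw [pow_zero] at h1
    exact h1.trans hadd (rel_diag_one hq hF hξ)
  · right
    rcases le_or_gt r ((q + 1) / 2) with hr' | hr'
    · exact ⟨r, hr, hr', h1⟩
    · refine ⟨q + 1 - r, by omega, by omega, (h1.trans hadd
        (rel_diag_inv hq0 (pow_ne_zero r hξ0))).trans hadd ?_⟩
      -- Scaling by the norm ξ^(q+1) turns ξ^(-r) into ξ^(q+1-r).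
      convert rel_diag_mul hq0 (ξ ^ r)⁻¹ hξ0 using 2
      rw [← pow_sub₀ _ hξ0 hlt.le]

theorem rel_antidiag_cases (hq : Odd q) (hF : Fintype.card F = q ^ 2)
    (hξ : IsPrimitiveRoot ξ (q ^ 2 - 1)) {x : F} (hx : x ≠ 0) :
    Rel q ![0, x, 1, 0] ![0, 1, 1, 0] ∨
      ∃ j, 1 ≤ j ∧ j ≤ (q - 1) / 2 ∧ Rel q ![0, x, 1, 0] ![0, ξ ^ j, 1, 0] := by
  have hq0 : q ≠ 0 := by rintro rfl; simp at hq
  have h3 := three_le_of_card hq hF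
  have hadd := add_pow_of_card (L := F) hF
  have hξ0 := ne_zero_of_isPrimitiveRoot hq hF hξ
  have hξ' := sq_sub_one_eq hq ▸ hξ
  obtain ⟨j, rfl⟩ := exists_pow_eq_of_ne_zero hξ' (card_eq_mul_add_one hq hF) hx
  have e : ξ ^ j = (ξ ^ (j / (q - 1))) ^ (q - 1) * ξ ^ (j % (q - 1)) := by
    rw [← pow_mul, ← pow_add, mul_comm, Nat.div_add_mod]
  have h1 := (rel_antidiag_mul hq0 (ξ ^ (j % (q - 1)))
    (pow_ne_zero (j / (q - 1)) hξ0)).symm hq0 hadd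
  rw [← e] at h1
  have hlt : j % (q - 1) < q - 1 := Nat.mod_lt _ (by omega)
  generalize j % (q - 1) = r at h1 hlt
  rcases Nat.eq_zero_or_pos r with rfl | hr
  · left
    rwa [pow_zero] at h1
  · right
    rcases le_or_gt r ((q - 1) / 2) with hr' | hr'
    · exact ⟨r, hr, hr', h1⟩
    · refine ⟨q - 1 - r, by omega, by omega, (h1.trans hadd
        (rel_antidiag_inv hq0 (pow_ne_zero r hξ0))).trans hadd ?_⟩
      convert rel_antidiag_mul hq0 (ξ ^ r)⁻¹ hξ0 using 3
      rw [← pow_sub₀ _ hξ0 hlt.le]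

/-- A vector with first coordinate zero and rank two can be brought to antidiagonal form, or to
`(0, 1, 1, η)` with a fixed `η` such that `η^q = -η`. -/
theorem rel_isotropic_cases (hq : Odd q) (hF : Fintype.card F = q ^ 2)
    (hξ : IsPrimitiveRoot ξ (q ^ 2 - 1)) {y : F} (hy : y ≠ 0) (w : F) :
    (∃ x, x ≠ 0 ∧ Rel q ![0, y, 1, w] ![0, x, 1, 0]) ∨
      Rel q ![0, y, 1, w] ![0, 1, 1, ξ ^ ((q + 1) / 2)] := by
  have hq0 : q ≠ 0 := by rintro rfl; simp at hq
  have hadd := add_pow_of_card (L := F) hF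
  have hqq := pow_pow_of_card (F := F) hF
  have hξ0 := ne_zero_of_isPrimitiveRoot hq hF hξ
  have h2 := two_ne_zero_of_card hq hF
  -- The corner w can be changed by the values of s ↦ s^q y + s, an additive map that is bijective
  -- when y has norm different from 1. For norm 1 one may take y = 1, and then w can be changed only
  -- by traces.
  by_cases hN : y ^ (q + 1) = 1
  · obtain ⟨a, ha, ha'⟩ := exists_pow_sub_one_eq hq hF hξ (x := y⁻¹) (by rw [inv_pow, hN, inv_one])
    obtain ⟨w', h1⟩ : ∃ w', Rel q ![0, y, 1, w] ![0, 1, 1, w'] := by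
      have haq : a ^ q = a * y⁻¹ := by
        rw [← ha', ← pow_succ', Nat.sub_add_cancel (by omega)]
      refine ⟨a⁻¹ * w, rel_of_eq a 0 0 1 a (by simpa) ha ?_ ?_ ?_ ?_⟩ <;> simp [hq0, ha]
      rw [haq, mul_assoc, inv_mul_cancel₀ hy, mul_one]
    -- The skew part of w', left after the trace part is removed by s = -(w' + w'^q)/4.
    set δ := (w' - w' ^ q) / 2 with hδ
    have h2q : (2 : F) ^ q = 2 := by rw [← one_add_one_eq_two, hadd, one_pow]
    have hδq : δ ^ q = -δ := by
      rw [hδ, div_pow, sub_pow_of_add_pow hadd, hqq, h2q]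
      ring
    have h3 : Rel q ![0, 1, 1, w'] ![0, 1, 1, δ] := by
      have := rel_antidiag_shift hq0 1 w' (-(w' + w' ^ q) / 4)
      convert this using 5
      have h4 : (4 : F) ^ q = 4 := by
        rw [show (4 : F) = 2 * 2 by norm_num, mul_pow, h2q]
      have h4' : (4 : F) ≠ 0 := by rw [show (4 : F) = 2 * 2 by norm_num]; exact mul_ne_zero h2 h2
      rw [hδ, div_pow, hq.neg_pow, hadd, hqq, h4]
      field_simp
      ring
    have h4 := h1.trans hadd h3
    by_cases hδ0 : δ = 0
    · left
      exact ⟨1, one_ne_zero, by rwa [hδ0] at h4⟩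
    · right
      have hη := pow_half_pow hq hF hξ
      set η := ξ ^ ((q + 1) / 2) with hη'
      have hη0 : η ≠ 0 := pow_ne_zero _ hξ0
      -- Both δ and η are negated by the q-power map, so δ/η lies in F_q and is a norm; scaling by
      -- diag(a, a^(-q)) replaces δ by η.
      obtain ⟨a, ha, ha'⟩ := exists_pow_add_one_eq hq hF hξ (x := δ / η) (div_ne_zero hδ0 hη0)
        (by rw [div_pow, hδq, hη, neg_div_neg_eq])
      refine h4.trans hadd (rel_of_eq a 0 0 (a⁻¹ ^ q) 1 ?_ one_ne_zero ?_ ?_ ?_ ?_) <;>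
        simp [hq0, ha, hqq]
      rw [pow_succ'] at ha'
      rw [inv_mul_eq_iff_eq_mul₀ ha, inv_mul_eq_iff_eq_mul₀ (pow_ne_zero _ ha), ← mul_assoc,
        mul_comm (a ^ q), ha', div_mul_cancel₀ _ hη0]
  · left
    refine ⟨y, hy, ?_⟩
    let f : F →+ F :=
      { toFun := fun s => s ^ q * y + s
        map_zero' := by simp [hq0]
        map_add' := fun s t => by rw [hadd]; ring }
    have hf : Function.Injective f := by
      rw [injective_iff_map_eq_zero]
      intro s hs
      by_contra hs0
      apply hN
      have e1 : s ^ q * y = -s := eq_neg_of_add_eq_zero_left hs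
      have e2 : s * y ^ q = -s ^ q := by
        rw [← hq.neg_pow, ← e1, mul_pow, hqq]
      have : s ^ q * s * y ^ (q + 1) = s ^ q * s := by
        rw [pow_succ y]
        linear_combination s * y ^ q * e1 - s * e2
      exact mul_left_cancel₀ (mul_ne_zero (pow_ne_zero q hs0) hs0) (by rw [this, mul_one])
    obtain ⟨s, hs⟩ := (Finite.injective_iff_surjective.1 hf) (-w)
    have := rel_antidiag_shift hq0 y w s
    rwa [show s ^ q * y + s = -w from hs, neg_add_cancel] at this

/-- Every vector is related to exactly one of these; here is the existence part. -/
theorem exists_rel_normalForm (hq : Odd q) (hF : Fintype.card F = q ^ 2)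
    (hξ : IsPrimitiveRoot ξ (q ^ 2 - 1)) {v : Fin 4 → F} (hv : v ≠ 0) :
    Rel q v ![1, 0, 0, 0] ∨ Rel q v ![0, 1, 0, 0] ∨ Rel q v ![0, 1, 1, 0] ∨
      Rel q v ![0, 1, 1, ξ ^ ((q + 1) / 2)] ∨
      (∃ j, 1 ≤ j ∧ j ≤ (q + 1) / 2 ∧ Rel q v ![ξ ^ j, 0, 0, 1]) ∨
      ∃ k, 1 ≤ k ∧ k ≤ (q - 1) / 2 ∧ Rel q v ![0, ξ ^ k, 1, 0] := by
  have hq0 : q ≠ 0 := by rintro rfl; simp at hq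
  have hadd := add_pow_of_card (L := F) hF
  have hqq := pow_pow_of_card (F := F) hF
  by_cases hD : quadForm v = 0
  · rcases rel_of_quadForm_eq_zero hq0 hadd hqq hv hD with h | h
    · exact Or.inl h
    · exact Or.inr (Or.inl h)
  right; right
  have anti {x : F} (hx : x ≠ 0) (h : Rel q v ![0, x, 1, 0]) : Rel q v ![0, 1, 1, 0] ∨
      ∃ k, 1 ≤ k ∧ k ≤ (q - 1) / 2 ∧ Rel q v ![0, ξ ^ k, 1, 0] := by
    rcases rel_antidiag_cases hq hF hξ hx with h' | ⟨k, h1, h2, h'⟩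
    · exact Or.inl (h.trans hadd h')
    · exact Or.inr ⟨k, h1, h2, h.trans hadd h'⟩
  rcases exists_rel_of_quadForm_ne_zero hq hF hD with ⟨x, hx, h⟩ | ⟨y, w, hy, h⟩
  · rcases rel_diag_cases hq hF hξ hx with h' | ⟨j, h1, h2, h'⟩
    · exact Or.inl (h.trans hadd h')
    · exact Or.inr (Or.inr (Or.inl ⟨j, h1, h2, h.trans hadd h'⟩))
  · rcases rel_isotropic_cases hq hF hξ hy w with ⟨x, hx, h'⟩ | h'
    · rcases anti hx (h.trans hadd h') with h | h
      · exact Or.inl h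
      · exact Or.inr (Or.inr (Or.inr h))
    · exact Or.inr (Or.inl (h.trans hadd h'))

end NormalForm

/-! ### Invariants of congruence -/

section Invariants

variable {F : Type*} [Field F] {q : ℕ}

/-- Some nonzero multiple of `v` is of the form `(a, b, b^q, c)` with `a^q = a` and `c^q = c`. -/
def IsHermitian (q : ℕ) (v : Fin 4 → F) : Prop :=
  ∃ k : F, k ≠ 0 ∧ (k * v 0) ^ q = k * v 0 ∧ k * v 2 = (k * v 1) ^ q ∧ (k * v 3) ^ q = k * v 3

theorem Rel.isHermitian (hadd : ∀ x y : F, (x + y) ^ q = x ^ q + y ^ q)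
    (hqq : ∀ x : F, (x ^ q) ^ q = x) {v w : Fin 4 → F} (h : Rel q v w) (hv : IsHermitian q v) :
    IsHermitian q w := by
  obtain ⟨A, -, c, hc, h⟩ := h
  obtain ⟨k, hk, h0, h2, h3⟩ := hv
  have e (i : Fin 4) : k * c * w i = (frobTensor q A).mulVec (k • v) i := by
    rw [Matrix.mulVec_smul, h]
    simp
    ring
  have h1 : (k * v 2) ^ q = k * v 1 := by rw [h2, hqq]
  refine ⟨k * c, mul_ne_zero hk hc, ?_, ?_, ?_⟩ <;> simp only [e, frobTensor_mulVec] <;>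
    simp [hadd, mul_pow (_ ^ q), mul_pow (A _ _), hqq, h0, h1, h3, ← h2] <;> ring

theorem Rel.quadForm_hermForm (hadd : ∀ x y : F, (x + y) ^ q = x ^ q + y ^ q)
    (hqq : ∀ x : F, (x ^ q) ^ q = x) {v w : Fin 4 → F} (h : Rel q v w) :
    ∃ d k : F, d ≠ 0 ∧ k ≠ 0 ∧ k ^ 2 * quadForm w = d ^ (q + 1) * quadForm v ∧
      k ^ (q + 1) * hermForm q w = d ^ (q + 1) * hermForm q v := by
  obtain ⟨A, hA, k, hk, h⟩ := h
  refine ⟨A.det, k, hA, hk, ?_, ?_⟩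
  · rw [← quadForm_frobTensor hadd, h, quadForm_smul]
  · rw [← hermForm_frobTensor hadd hqq, h, hermForm_smul]

theorem Rel.quadForm_eq_zero (hadd : ∀ x y : F, (x + y) ^ q = x ^ q + y ^ q)
    (hqq : ∀ x : F, (x ^ q) ^ q = x) {v w : Fin 4 → F} (h : Rel q v w) :
    quadForm w = 0 ↔ quadForm v = 0 := by
  obtain ⟨d, k, hd, hk, h1, -⟩ := h.quadForm_hermForm hadd hqq
  rw [← mul_eq_zero_iff_left (pow_ne_zero 2 hk), h1,
    mul_eq_zero_iff_left (pow_ne_zero (q + 1) hd)]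

theorem Rel.hermForm_eq_zero (hadd : ∀ x y : F, (x + y) ^ q = x ^ q + y ^ q)
    (hqq : ∀ x : F, (x ^ q) ^ q = x) {v w : Fin 4 → F} (h : Rel q v w) :
    hermForm q w = 0 ↔ hermForm q v = 0 := by
  obtain ⟨d, k, hd, hk, -, h1⟩ := h.quadForm_hermForm hadd hqq
  rw [← mul_eq_zero_iff_left (pow_ne_zero (q + 1) hk), h1,
    mul_eq_zero_iff_left (pow_ne_zero (q + 1) hd)]

/-- The factor d^(q+1) is in F_q, so its (q+1)-st power is its square, and h² and D^(q+1) scale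
alike. -/
theorem Rel.hermForm_sq_eq (hadd : ∀ x y : F, (x + y) ^ q = x ^ q + y ^ q)
    (hqq : ∀ x : F, (x ^ q) ^ q = x) {v w : Fin 4 → F} (h : Rel q v w) {j : F}
    (hv : hermForm q v ^ 2 = j * quadForm v ^ (q + 1)) :
    hermForm q w ^ 2 = j * quadForm w ^ (q + 1) := by
  obtain ⟨d, k, hd, hk, h1, h2⟩ := h.quadForm_hermForm hadd hqq
  have e1 : (d ^ (q + 1)) ^ (q + 1) = (d ^ (q + 1)) ^ 2 := by
    rw [pow_succ (d ^ (q + 1)), pow_succ d, mul_pow, hqq]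
    ring
  apply mul_left_cancel₀ (pow_ne_zero (2 * (q + 1)) hk)
  calc k ^ (2 * (q + 1)) * hermForm q w ^ 2 = (k ^ (q + 1) * hermForm q w) ^ 2 := by ring
    _ = (d ^ (q + 1)) ^ 2 * hermForm q v ^ 2 := by rw [h2]; ring
    _ = (d ^ (q + 1)) ^ (q + 1) * (j * quadForm v ^ (q + 1)) := by rw [hv, e1]
    _ = j * (d ^ (q + 1) * quadForm v) ^ (q + 1) := by rw [mul_pow _ (quadForm v)]; ring
    _ = j * (k ^ 2 * quadForm w) ^ (q + 1) := by rw [h1]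
    _ = _ := by rw [mul_pow, ← pow_mul]; ring

/-- D changes by d^(q+1)/k², a square because q + 1 is even. -/
theorem Rel.isSquare (hq : Odd q) (hadd : ∀ x y : F, (x + y) ^ q = x ^ q + y ^ q)
    (hqq : ∀ x : F, (x ^ q) ^ q = x) {v w : Fin 4 → F} (h : Rel q v w) {j : F}
    (hv : IsSquare (j * quadForm v)) : IsSquare (j * quadForm w) := by
  obtain ⟨d, k, hd, hk, h1, -⟩ := h.quadForm_hermForm hadd hqq
  obtain ⟨s, hs⟩ := hv
  obtain ⟨m, rfl⟩ := hq
  refine ⟨s * d ^ (m + 1) / k, ?_⟩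
  field_simp
  have : d ^ (2 * m + 1 + 1) = d ^ (m + 1) * d ^ (m + 1) := by ring
  rw [this] at h1
  linear_combination j * h1 + d ^ (m + 1) * d ^ (m + 1) * hs

end Invariants

/-! ### The point sets in terms of coordinates -/

section Points

variable {F : Type*} [Field F] {q : ℕ}

theorem mk_mem_zeroLocus {φ : (Fin 4 → F) → F} {n : ℕ}
    (hφ : ∀ (c : F) (v : Fin 4 → F), φ (c • v) = c ^ n * φ v) {v : Fin 4 → F} (hv : v ≠ 0) :
    (.mk F v hv : PG3 F) ∈ zeroLocus φ ↔ φ v = 0 := by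
  obtain ⟨a, ha⟩ := Projectivization.exists_smul_eq_mk_rep F v hv
  change φ (Projectivization.rep _) = 0 ↔ _
  rw [← ha, Units.smul_def, hφ,
    mul_eq_zero_iff_left (pow_ne_zero n a.ne_zero)]

theorem mk_mem_hypQuadric {v : Fin 4 → F} (hv : v ≠ 0) :
    (.mk F v hv : PG3 F) ∈ hypQuadric F ↔ quadForm v = 0 :=
  mk_mem_zeroLocus quadForm_smul hv

theorem mk_mem_hermSurface {v : Fin 4 → F} (hv : v ≠ 0) :
    (.mk F v hv : PG3 F) ∈ hermSurface F q ↔ hermForm q v = 0 :=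
  mk_mem_zeroLocus hermForm_smul hv

theorem mk_mem_surface (hq : Odd q) (γ : F) {v : Fin 4 → F} (hv : v ≠ 0) :
    (.mk F v hv : PG3 F) ∈ surface q γ ↔ hermForm q v = γ * quadForm v ^ ((q + 1) / 2) := by
  rw [surface, mk_mem_zeroLocus (n := q + 1), sub_eq_zero]
  intro c v
  have : (c ^ 2) ^ ((q + 1) / 2) = c ^ (q + 1) := by
    rw [← pow_mul]
    obtain ⟨m, rfl⟩ := hq
    congr 1
    omega
  rw [hermForm_smul, quadForm_smul, mul_pow, this]
  ring

/-- b = -a⁻¹ makes the second coefficient the negative of the first, so the union is given by one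
squared equation. -/
theorem mk_mem_surface_union (hq : Odd q) {a b : F} (hab : a * b = -1) {v : Fin 4 → F}
    (hv : v ≠ 0) :
    (.mk F v hv : PG3 F) ∈ surface q (a + a⁻¹) ∪ surface q (b + b⁻¹) ↔
      hermForm q v ^ 2 = (a ^ 2 + (a ^ 2)⁻¹ + 2) * quadForm v ^ (q + 1) := by
  have ha : a ≠ 0 := by rintro rfl; simp at hab
  have hb : b = -a⁻¹ := by
    field_simp
    linear_combination hab
  have hD : quadForm v ^ (q + 1) = (quadForm v ^ ((q + 1) / 2)) ^ 2 := by
    rw [← pow_mul]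
    obtain ⟨m, rfl⟩ := hq
    congr 1
    omega
  rw [Set.mem_union, mk_mem_surface hq, mk_mem_surface hq, hD, hb]
  generalize quadForm v ^ ((q + 1) / 2) = D
  have e1 : a ^ 2 + (a ^ 2)⁻¹ + 2 = (a + a⁻¹) ^ 2 := by
    field_simp
    ring
  have e2 : (-a⁻¹ + (-a⁻¹)⁻¹) * D = -((a + a⁻¹) * D) := by
    rw [inv_neg, inv_inv]
    ring
  rw [e1, e2, ← mul_pow, sq_eq_sq_iff_eq_or_eq_neg]

theorem mk_mem_baerSigma {v : Fin 4 → F} (hv : v ≠ 0) :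
    (.mk F v hv : PG3 F) ∈ baerSigma F q ↔ IsHermitian q v := by
  constructor
  · rintro ⟨a, b, c, h, ha, hc, hP⟩
    obtain ⟨k, hk⟩ := (Projectivization.mk_eq_mk_iff _ _ _ _ _).1 hP
    subst hk
    exact ⟨(k⁻¹ : Fˣ), Units.ne_zero _, by simp [Units.smul_def, ha, hc]⟩
  · rintro ⟨k, hk, h0, h2, h3⟩
    have e : ![k * v 0, k * v 1, (k * v 1) ^ q, k * v 3] = k • v := by
      rw [← h2]
      ext i
      fin_cases i <;> simp
    refine ⟨k * v 0, k * v 1, k * v 3, by rw [e]; exact smul_ne_zero hk hv, h0, h3, ?_⟩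
    rw [Projectivization.mk_eq_mk_iff']
    refine ⟨k⁻¹, ?_⟩
    rw [e, inv_smul_smul₀ hk]

/-- A rank-one point is congruent to (1, 0, 0, 0), which lies on the curve, or to (0, 1, 0, 0),
where h = -1. -/
theorem mk_mem_setO (hq0 : q ≠ 0) (hadd : ∀ x y : F, (x + y) ^ q = x ^ q + y ^ q)
    (hqq : ∀ x : F, (x ^ q) ^ q = x) {v : Fin 4 → F} (hv : v ≠ 0) :
    (.mk F v hv : PG3 F) ∈ setO F q ↔ quadForm v = 0 ∧ hermForm q v = 0 := by
  rw [setO, mem_veronese_iff hq0]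
  constructor
  · rintro ⟨u, hu, h⟩
    obtain ⟨c, rfl⟩ := (Projectivization.mk_eq_mk_iff' _ _ _ _ _).1 h
    rw [quadForm_smul, hermForm_smul]
    constructor
    · simp [quadForm, ver]
      right
      ring
    · simp [hermForm, ver, pow_succ, mul_pow, hqq]
      right
      ring
  · rintro ⟨hD, hH⟩
    rcases rel_of_quadForm_eq_zero hq0 hadd hqq hv hD with h | h
    · obtain ⟨A, hA, c, hc, h⟩ := h.symm hq0 hadd
      have e : (![1, 0, 0, 0] : Fin 4 → F) = ver q ![1, 0] := by simp [ver, hq0]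
      rw [e, frobTensor_mulVec_ver hadd] at h
      refine ⟨A.mulVec ![1, 0], fun h0 => ?_, ?_⟩
      · rw [h0] at h
        have : ver q (0 : Fin 2 → F) = 0 := by simp [ver, hq0]
        rw [this, eq_comm, smul_eq_zero] at h
        exact h.elim hc hv
      · rw [Projectivization.mk_eq_mk_iff']
        exact ⟨c⁻¹, by rw [h, inv_smul_smul₀ hc]⟩
    · exfalso
      rw [← h.hermForm_eq_zero hadd hqq] at hH
      simp [hermForm, hq0] at hH

variable [Fintype F]

theorem mk_mem_orbit_groupG (hq : Odd q) (hF : Fintype.card F = q ^ 2) {v w : Fin 4 → F}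
    (hv : v ≠ 0) (hw : w ≠ 0) :
    (.mk F w hw : PG3 F) ∈ MulAction.orbit (groupG F q) (.mk F v hv : PG3 F) ↔ Rel q v w := by
  have hq0 : q ≠ 0 := by rintro rfl; simp at hq
  have hadd := add_pow_of_card (L := F) hF
  rw [groupG_eq_range hq0 hadd (three_le_of_card hq hF) hF]
  constructor
  · rintro ⟨⟨_, g, rfl⟩, h⟩
    induction g using Matrix.ProjGenLinGroup.induction_on with | mk A =>
    replace h : Matrix.ProjGenLinGroup.mk (frobGL hq0 hadd A) • (.mk F v hv : PG3 F) =
      .mk F w hw := h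
    rw [mk_smul_mk _ hv (mulVec_ne_zero _ hv) rfl, Projectivization.mk_eq_mk_iff] at h
    obtain ⟨c, hc⟩ := h
    exact ⟨A.1, A.det_ne_zero, c, c.ne_zero, hc.symm⟩
  · rintro ⟨A, hA, c, hc, h⟩
    refine ⟨⟨_, .mk (Matrix.GeneralLinearGroup.mkOfDetNeZero A hA), rfl⟩, ?_⟩
    change Matrix.ProjGenLinGroup.mk (frobGL hq0 hadd _) • (.mk F v hv : PG3 F) = .mk F w hw
    rw [mk_smul_mk _ hv (mulVec_ne_zero _ hv) rfl, Projectivization.mk_eq_mk_iff']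
    exact ⟨c, h.symm⟩

end Points

/-! ### Labels of the orbits and their separation -/

section Invariant

variable {F : Type*} [Field F] [Fintype F] {q : ℕ} {ξ : F}

/-- The value of `h² / D^(q+1)` on the points of rank two, indexed by an exponent. -/
def invariantJ (ξ : F) (e : ℕ) : F := ξ ^ e + (ξ ^ e)⁻¹ + 2

/-- x + x⁻¹ = y + y⁻¹ means x = y or xy = 1. With both exponents at most (q² - 1)/2, the second case
occurs only if both are 0 or both are (q² - 1)/2. -/
theorem invariantJ_injOn (hq : Odd q) (hF : Fintype.card F = q ^ 2)
    (hξ : IsPrimitiveRoot ξ (q ^ 2 - 1)) {e e' : ℕ} (he : 2 * e ≤ (q - 1) * (q + 1))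
    (he' : 2 * e' ≤ (q - 1) * (q + 1)) (h : invariantJ ξ e = invariantJ ξ e') : e = e' := by
  have hξ0 := ne_zero_of_isPrimitiveRoot hq hF hξ
  have h3 := three_le_of_card hq hF
  have hpos : 0 < (q - 1) * (q + 1) := Nat.mul_pos (by omega) (by omega)
  rw [sq_sub_one_eq hq] at hξ
  have hx : ξ ^ e ≠ 0 := pow_ne_zero _ hξ0
  have hy : ξ ^ e' ≠ 0 := pow_ne_zero _ hξ0
  have : (ξ ^ e - ξ ^ e') * (ξ ^ (e + e') - 1) = 0 := by
    rw [invariantJ, invariantJ] at h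
    field_simp at h
    rw [pow_add]
    linear_combination h
  rcases mul_eq_zero.1 this with h | h
  · exact hξ.pow_inj (by omega) (by omega) (sub_eq_zero.1 h)
  · rw [sub_eq_zero, hξ.pow_eq_one_iff_dvd] at h
    rcases Nat.eq_zero_or_pos (e + e') with h0 | h0
    · omega
    · have := Nat.le_of_dvd h0 h
      omega

/-- The labels of the orbits. -/
abbrev OrbitLabel (q : ℕ) : Type := Fin 6 ⊕ Fin ((q - 1) / 2) ⊕ Fin ((q - 3) / 2)

/-- A representative of each orbit. -/
def orbitRep (q : ℕ) (ξ : F) : OrbitLabel q → Fin 4 → F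
  | .inl 0 => ![1, 0, 0, 0]
  | .inl 1 => ![0, 1, 0, 0]
  | .inl 2 => ![0, 1, 1, 0]
  | .inl 3 => ![0, 1, 1, ξ ^ ((q + 1) / 2)]
  | .inl 4 => ![ξ ^ ((q + 1) / 2), 0, 0, 1]
  | .inl 5 => ![0, ξ ^ ((q - 1) / 2), 1, 0]
  | .inr (.inl j) => ![ξ ^ (j.1 + 1), 0, 0, 1]
  | .inr (.inr k) => ![0, ξ ^ (k.1 + 1), 1, 0]

/-- The exponent of the invariant of each orbit of points of rank two. -/
def orbitExp (q : ℕ) : OrbitLabel q → ℕ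
  | .inl 4 => (q - 1) * ((q + 1) / 2)
  | .inl 5 => (q - 1) * ((q + 1) / 2)
  | .inl _ => 0
  | .inr (.inl j) => (q - 1) * (j.1 + 1)
  | .inr (.inr k) => (q + 1) * (k.1 + 1)

/-- The condition that distinguishes an orbit from those with the same invariant. -/
def orbitCond (q : ℕ) (ξ : F) (v : Fin 4 → F) : OrbitLabel q → Prop
  | .inl 0 => hermForm q v = 0
  | .inl 1 => ¬hermForm q v = 0
  | .inl 2 => IsHermitian q v
  | .inl 3 => ¬IsHermitian q v
  | .inl 4 => IsSquare (ξ ^ ((q + 1) / 2) * quadForm v)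
  | .inl 5 => ¬IsSquare (ξ ^ ((q + 1) / 2) * quadForm v)
  | .inr _ => True

/-- The condition on the vanishing of the quadratic form, or else on the invariant. -/
def orbitInv (q : ℕ) (ξ : F) (v : Fin 4 → F) : OrbitLabel q → Prop
  | .inl 0 => quadForm v = 0
  | .inl 1 => quadForm v = 0
  | i => quadForm v ≠ 0 ∧ hermForm q v ^ 2 = invariantJ ξ (orbitExp q i) * quadForm v ^ (q + 1)

theorem two_mul_orbitExp_le (hq : Odd q) (hq3 : 3 ≤ q) (i : OrbitLabel q) :
    2 * orbitExp q i ≤ (q - 1) * (q + 1) := by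
  obtain ⟨m, rfl⟩ := hq
  rcases i with i | j | k
  · have : 2 * ((2 * m + 1 - 1) * ((2 * m + 1 + 1) / 2)) ≤ (2 * m + 1 - 1) * (2 * m + 1 + 1) := by
      rw [Nat.mul_left_comm]
      exact Nat.mul_le_mul_left _ (by omega)
    fin_cases i <;> simp only [orbitExp, mul_zero, Nat.zero_le] <;> exact this
  · have := j.2
    simp only [orbitExp]
    rw [Nat.mul_left_comm]
    exact Nat.mul_le_mul_left _ (by omega)
  · have := k.2
    simp only [orbitExp]
    rw [Nat.mul_left_comm, mul_comm (2 * m + 1 - 1)]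
    exact Nat.mul_le_mul_left _ (by omega)

/-- The indices in the two families stop short of the exponent (q² - 1)/2 and start above 0. For the
labels 0 and 1, where D = 0, the exponent 0 is only a placeholder. -/
theorem orbitExp_inl_ne_inr (hq : Odd q) (hq3 : 3 ≤ q) (i : Fin 6)
    (j : Fin ((q - 1) / 2) ⊕ Fin ((q - 3) / 2)) : orbitExp q (.inl i) ≠ orbitExp q (.inr j) := by
  obtain ⟨m, rfl⟩ := hq
  have e1 : 2 * m + 1 - 1 = 2 * m := by omega
  have e2 : (2 * m + 1 + 1) / 2 = m + 1 := by omega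
  rcases j with j | k
  · have := j.2
    fin_cases i <;> simp only [orbitExp, e1, e2] <;> intro h
    · simp at h; omega
    · simp at h; omega
    · simp at h; omega
    · simp at h; omega
    · have := Nat.eq_of_mul_eq_mul_left (by omega) h; omega
    · have := Nat.eq_of_mul_eq_mul_left (by omega) h; omega
  · have := k.2
    have e3 : 2 * m * (m + 1) = (2 * m + 1 + 1) * m := by ring
    fin_cases i <;> simp only [orbitExp, e1, e2, e3] <;> intro h
    · simp at h
    · simp at h
    · simp at h
    · simp at h
    · have := Nat.eq_of_mul_eq_mul_left (by omega) h; omega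
    · have := Nat.eq_of_mul_eq_mul_left (by omega) h; omega

theorem orbitExp_inr_injective (hq : Odd q) (hq3 : 3 ≤ q) :
    Function.Injective fun j => orbitExp q (.inr j) := by
  have key (j : Fin ((q - 1) / 2)) (k : Fin ((q - 3) / 2)) :
      (q - 1) * (j.1 + 1) ≠ (q + 1) * (k.1 + 1) := by
    obtain ⟨m, rfl⟩ := hq
    intro h
    -- With q = 2m + 1, coprimality of m and m + 1 makes m + 1 divide the index j + 1, which is at
    -- most m.
    have e : m * (j.1 + 1) = (m + 1) * (k.1 + 1) := by
      apply Nat.eq_of_mul_eq_mul_left (show 0 < 2 by omega)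
      simp only [show 2 * m + 1 - 1 = 2 * m by omega] at h
      linarith
    have hc : Nat.Coprime (m + 1) m := by simp
    have := Nat.le_of_dvd (by omega) (hc.dvd_of_dvd_mul_left ⟨_, e⟩)
    have := j.2
    omega
  rintro (j | k) (j' | k') h <;> simp only [orbitExp] at h
  · have := Nat.eq_of_mul_eq_mul_left (by omega) h
    congr 2
    apply Fin.ext
    omega
  · exact absurd h (key _ _)
  · exact absurd h.symm (key _ _)
  · have := Nat.eq_of_mul_eq_mul_left (by omega) h
    congr 2
    apply Fin.ext
    omega

/-- The conditions for different labels exclude each other. -/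
theorem orbitLabel_unique (hq : Odd q) (hF : Fintype.card F = q ^ 2)
    (hξ : IsPrimitiveRoot ξ (q ^ 2 - 1)) {v : Fin 4 → F} {i j : OrbitLabel q}
    (hi : orbitInv q ξ v i) (hi' : orbitCond q ξ v i) (hj : orbitInv q ξ v j)
    (hj' : orbitCond q ξ v j) : i = j := by
  have h3 := three_le_of_card hq hF
  have key : quadForm v ≠ 0 → orbitExp q i = orbitExp q j := by
    intro hD
    have aux {l : OrbitLabel q} (hl : orbitInv q ξ v l) :
        hermForm q v ^ 2 = invariantJ ξ (orbitExp q l) * quadForm v ^ (q + 1) := by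
      rcases l with l | l | l
      · fin_cases l
        · exact absurd hl hD
        · exact absurd hl hD
        all_goals exact hl.2
      · exact hl.2
      · exact hl.2
    apply invariantJ_injOn hq hF hξ (two_mul_orbitExp_le hq h3 i) (two_mul_orbitExp_le hq h3 j)
    exact mul_right_cancel₀ (pow_ne_zero (q + 1) hD) ((aux hi).symm.trans (aux hj))
  have h45 : (q - 1) * ((q + 1) / 2) ≠ 0 := mul_ne_zero (by omega) (by omega)
  have inr {l} (hl : orbitInv q ξ v (.inr l)) : quadForm v ≠ 0 := by
    rcases l with l | l
    · exact hl.1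
    · exact hl.1
  rcases i with i | i <;> rcases j with j | j
  · congr 1
    fin_cases i <;> fin_cases j <;>
      first
      | rfl
      | exact absurd hi hj.1
      | exact absurd hj hi.1
      | exact absurd hi' hj'
      | exact absurd hj' hi'
      | exact absurd (key hi.1) h45
      | exact absurd (key hi.1).symm h45
  · exact absurd (key (inr hj)) (orbitExp_inl_ne_inr hq h3 _ _)
  · exact absurd (key (inr hi)).symm (orbitExp_inl_ne_inr hq h3 _ _)
  · rw [orbitExp_inr_injective hq h3 (key (inr hi))]

end Invariant

/-! ### Representatives, and orbits described by invariants -/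

section Orbits

variable {F : Type*} [Field F] {q : ℕ} {ξ : F}

theorem orbitRep_ne_zero (i : OrbitLabel q) : orbitRep q ξ i ≠ 0 := by
  intro h
  rcases i with i | i | i
  · fin_cases i
    · simpa [orbitRep] using congrFun h 0
    · simpa [orbitRep] using congrFun h 1
    · simpa [orbitRep] using congrFun h 1
    · simpa [orbitRep] using congrFun h 1
    · simpa [orbitRep] using congrFun h 3
    · simpa [orbitRep] using congrFun h 2
  · simpa [orbitRep] using congrFun h 3
  · simpa [orbitRep] using congrFun h 2

/-- The point with the coordinates of `orbitRep`. -/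
def orbitPoint (q : ℕ) (ξ : F) (i : OrbitLabel q) : PG3 F :=
  .mk F (orbitRep q ξ i) (orbitRep_ne_zero i)

/-- The set with a given label. -/
def orbitSet (q : ℕ) (ξ : F) : OrbitLabel q → Set (PG3 F)
  | .inl 0 => setO F q
  | .inl 1 => hypQuadric F \ setO F q
  | .inl 2 => baerSigma F q \ setO F q
  | .inl 3 => mergedE0 q ξ
  | .inl 4 => setH1 q ξ
  | .inl 5 => setH2 q ξ
  | .inr (.inl j) => mergedS q ξ (j.1 + 1)
  | .inr (.inr k) => mergedE q ξ (k.1 + 1)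

theorem orbitList_eq_range : orbitList q ξ = Set.range (orbitSet q ξ) := by
  ext X
  constructor
  · rintro ((h | ⟨j, h1, h2, rfl⟩) | ⟨k, h1, h2, rfl⟩)
    · rcases h with rfl | rfl | rfl | rfl | rfl | rfl
      · exact ⟨.inl 0, rfl⟩
      · exact ⟨.inl 2, rfl⟩
      · exact ⟨.inl 1, rfl⟩
      · exact ⟨.inl 4, rfl⟩
      · exact ⟨.inl 5, rfl⟩
      · exact ⟨.inl 3, rfl⟩
    · refine ⟨.inr (.inl ⟨j - 1, by omega⟩), ?_⟩
      simp only [orbitSet]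
      rw [Nat.sub_add_cancel h1]
    · refine ⟨.inr (.inr ⟨k - 1, by omega⟩), ?_⟩
      simp only [orbitSet]
      rw [Nat.sub_add_cancel h1]
  · rintro ⟨i | j | k, rfl⟩
    · left; left
      fin_cases i <;> simp [orbitSet]
    · left; right
      exact ⟨j.1 + 1, by omega, by omega, rfl⟩
    · right
      exact ⟨k.1 + 1, by omega, by omega, rfl⟩

theorem Rel.orbitInv (hadd : ∀ x y : F, (x + y) ^ q = x ^ q + y ^ q)
    (hqq : ∀ x : F, (x ^ q) ^ q = x) {v w : Fin 4 → F} (h : Rel q v w) {i : OrbitLabel q}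
    (hi : orbitInv q ξ v i) : orbitInv q ξ w i := by
  have h0 := h.quadForm_eq_zero hadd hqq
  have aux {j : F} (hj : quadForm v ≠ 0 ∧ hermForm q v ^ 2 = j * quadForm v ^ (q + 1)) :
      quadForm w ≠ 0 ∧ hermForm q w ^ 2 = j * quadForm w ^ (q + 1) :=
    ⟨mt h0.1 hj.1, h.hermForm_sq_eq hadd hqq hj.2⟩
  rcases i with i | i | i
  · fin_cases i
    · exact h0.2 hi
    · exact h0.2 hi
    all_goals exact aux hi
  · exact aux hi
  · exact aux hi

theorem Rel.orbitCond (hq : Odd q) (hadd : ∀ x y : F, (x + y) ^ q = x ^ q + y ^ q)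
    (hqq : ∀ x : F, (x ^ q) ^ q = x) {v w : Fin 4 → F} (h : Rel q v w) {i : OrbitLabel q}
    (hi : orbitCond q ξ v i) : orbitCond q ξ w i := by
  have h' := h.symm (by rintro rfl; simp at hq) hadd
  rcases i with i | i
  · fin_cases i
    · exact (h.hermForm_eq_zero hadd hqq).2 hi
    · exact mt (h.hermForm_eq_zero hadd hqq).1 hi
    · exact h.isHermitian hadd hqq hi
    · exact mt (h'.isHermitian hadd hqq) hi
    · exact h.isSquare hq hadd hqq hi
    · exact mt (h'.isSquare hq hadd hqq) hi
  · trivial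

theorem invariantJ_zero : invariantJ ξ 0 = 4 := by
  rw [invariantJ, pow_zero, inv_one]
  norm_num

theorem orbitInv_diag (hq : Odd q) {x : F} (hx : x ≠ 0) :
    quadForm ![x, 0, 0, 1] ≠ 0 ∧ hermForm q ![x, 0, 0, 1] ^ 2 =
      (x ^ (q - 1) + (x ^ (q - 1))⁻¹ + 2) * quadForm ![x, 0, 0, 1] ^ (q + 1) := by
  obtain ⟨m, rfl⟩ := hq
  refine ⟨by simpa [quadForm], ?_⟩
  simp [quadForm, hermForm]
  field_simp
  ring

theorem orbitInv_antidiag (hq : Odd q) {x : F} (hx : x ≠ 0) :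
    quadForm ![0, x, 1, 0] ≠ 0 ∧ hermForm q ![0, x, 1, 0] ^ 2 =
      (x ^ (q + 1) + (x ^ (q + 1))⁻¹ + 2) * quadForm ![0, x, 1, 0] ^ (q + 1) := by
  have hq0 : q ≠ 0 := by rintro rfl; simp at hq
  refine ⟨by simpa [quadForm], ?_⟩
  simp [quadForm, hermForm, hq0, hq.add_one.neg_pow]
  field_simp
  ring

variable [Fintype F]

/-- Raise to the power (q² - 1)/2: an odd power of ξ gives -1, a nonzero square gives 1. -/
theorem not_isSquare_pow (hq : Odd q) (hξ : IsPrimitiveRoot ξ (q ^ 2 - 1))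
    (hF : Fintype.card F = q ^ 2) {n : ℕ} (hn : Odd n) : ¬IsSquare (ξ ^ n) := by
  rintro ⟨s, hs⟩
  have h := congrArg (· ^ ((q - 1) * ((q + 1) / 2))) hs
  have hs1 : s ^ ((q - 1) * ((q + 1) / 2)) * s ^ ((q - 1) * ((q + 1) / 2)) = 1 := by
    have hs0 : s ≠ 0 := by
      rintro rfl
      rw [mul_zero] at hs
      exact pow_ne_zero n (ne_zero_of_isPrimitiveRoot hq hF hξ) hs
    rw [← pow_add, ← FiniteField.pow_card_sub_one_eq_one s hs0, card_eq_mul_add_one hq hF,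
      Nat.add_sub_cancel, ← mul_add]
    obtain ⟨m, rfl⟩ := hq
    congr 2
    omega
  simp only [mul_pow, hs1, ← pow_mul] at h
  rw [mul_comm, pow_mul, pow_half_eq_neg_one hq hF hξ, hn.neg_one_pow] at h
  exact two_ne_zero_of_card hq hF (by linear_combination -h)

theorem isSquare_neg_one (hq : Odd q) (hξ : IsPrimitiveRoot ξ (q ^ 2 - 1))
    (hF : Fintype.card F = q ^ 2) : IsSquare (-1 : F) := by
  rw [← pow_half_eq_neg_one hq hF hξ]
  obtain ⟨m, rfl⟩ := hq
  refine ⟨ξ ^ (m * (m + 1)), ?_⟩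
  rw [← pow_add]
  congr 1
  rw [show (2 * m + 1 + 1) / 2 = m + 1 by omega, show 2 * m + 1 - 1 = 2 * m by omega]
  ring

theorem invariantJ_half (hq : Odd q) (hF : Fintype.card F = q ^ 2)
    (hξ : IsPrimitiveRoot ξ (q ^ 2 - 1)) : invariantJ ξ ((q - 1) * ((q + 1) / 2)) = 0 := by
  rw [invariantJ, pow_half_eq_neg_one hq hF hξ, inv_neg, inv_one]
  norm_num

theorem orbitInv_orbitRep (hq : Odd q) (hF : Fintype.card F = q ^ 2)
    (hξ : IsPrimitiveRoot ξ (q ^ 2 - 1)) (i : OrbitLabel q) :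
    orbitInv q ξ (orbitRep q ξ i) i := by
  have hq0 : q ≠ 0 := by rintro rfl; simp at hq
  have hξ0 := ne_zero_of_isPrimitiveRoot hq hF hξ
  rcases i with i | j | k
  · fin_cases i
    · simp [orbitRep, orbitInv, quadForm]
    · simp [orbitRep, orbitInv, quadForm]
    · simp [orbitRep, orbitInv, quadForm, hermForm, orbitExp, invariantJ_zero, hq0,
        hq.add_one.neg_pow]
      norm_num
    · simp [orbitRep, orbitInv, quadForm, hermForm, orbitExp, invariantJ_zero, hq0,
        hq.add_one.neg_pow]
      norm_num
    · have := orbitInv_diag hq (pow_ne_zero ((q + 1) / 2) hξ0)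
      rwa [← pow_mul, mul_comm _ (q - 1)] at this
    · have := orbitInv_antidiag hq (pow_ne_zero ((q - 1) / 2) hξ0)
      have e : (q - 1) / 2 * (q + 1) = (q - 1) * ((q + 1) / 2) := by
        obtain ⟨m, rfl⟩ := hq
        rw [show (2 * m + 1 + 1) / 2 = m + 1 by omega, show 2 * m + 1 - 1 = 2 * m by omega,
          show 2 * m / 2 = m by omega]
        ring
      rwa [← pow_mul, e] at this
  · have := orbitInv_diag hq (pow_ne_zero (j.1 + 1) hξ0)
    rwa [← pow_mul, mul_comm _ (q - 1)] at this
  · have := orbitInv_antidiag hq (pow_ne_zero (k.1 + 1) hξ0)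
    rwa [← pow_mul, mul_comm _ (q + 1)] at this

theorem orbitCond_orbitRep (hq : Odd q) (hF : Fintype.card F = q ^ 2)
    (hξ : IsPrimitiveRoot ξ (q ^ 2 - 1)) (i : OrbitLabel q) :
    orbitCond q ξ (orbitRep q ξ i) i := by
  have hq0 : q ≠ 0 := by rintro rfl; simp at hq
  have hξ0 := ne_zero_of_isPrimitiveRoot hq hF hξ
  rcases i with i | i
  · fin_cases i
    · simp [orbitRep, orbitCond, hermForm, hq0]
    · simp [orbitRep, orbitCond, hermForm, hq0]
    · exact ⟨1, one_ne_zero, by simp [orbitRep, hq0]⟩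
    · rintro ⟨k, hk, -, h2, h3⟩
      simp [orbitRep] at h2 h3
      have hη := pow_half_pow hq hF hξ
      rw [mul_pow, ← h2, hη] at h3
      have : (2 : F) * (k * ξ ^ ((q + 1) / 2)) = 0 := by linear_combination -h3
      exact mul_ne_zero (two_ne_zero_of_card hq hF) (mul_ne_zero hk (pow_ne_zero _ hξ0)) this
    · simp [orbitRep, orbitCond, quadForm]
    · simp only [orbitCond, orbitRep]
      intro h
      apply not_isSquare_pow hq hξ hF hq
      have e : (q + 1) / 2 + (q - 1) / 2 = q := by
        obtain ⟨m, rfl⟩ := hq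
        omega
      have h' : ξ ^ q = ξ ^ ((q + 1) / 2) * quadForm ![0, ξ ^ ((q - 1) / 2), 1, 0] * -1 := by
        simp [quadForm]
        rw [← pow_add, e]
      rw [h']
      exact h.mul (isSquare_neg_one hq hξ hF)
  · trivial

theorem exists_rel_orbitRep (hq : Odd q) (hF : Fintype.card F = q ^ 2)
    (hξ : IsPrimitiveRoot ξ (q ^ 2 - 1)) {v : Fin 4 → F} (hv : v ≠ 0) :
    ∃ i, Rel q v (orbitRep q ξ i) := by
  rcases exists_rel_normalForm hq hF hξ hv with h | h | h | h | ⟨j, h1, h2, h⟩ | ⟨k, h1, h2, h⟩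
  · exact ⟨.inl 0, h⟩
  · exact ⟨.inl 1, h⟩
  · exact ⟨.inl 2, h⟩
  · exact ⟨.inl 3, h⟩
  · rcases eq_or_ne j ((q + 1) / 2) with rfl | hj
    · exact ⟨.inl 4, h⟩
    · refine ⟨.inr (.inl ⟨j - 1, by omega⟩), ?_⟩
      simp only [orbitRep]
      rwa [Nat.sub_add_cancel h1]
  · rcases eq_or_ne k ((q - 1) / 2) with rfl | hk
    · exact ⟨.inl 5, h⟩
    · refine ⟨.inr (.inr ⟨k - 1, by omega⟩), ?_⟩
      simp only [orbitRep]
      rwa [Nat.sub_add_cancel h1]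

/-- No converse reduction is needed: v is related to some representative, whose label must be i
since the conditions for distinct labels are exclusive. -/
theorem rel_orbitRep_iff (hq : Odd q) (hF : Fintype.card F = q ^ 2)
    (hξ : IsPrimitiveRoot ξ (q ^ 2 - 1)) {v : Fin 4 → F} (hv : v ≠ 0) (i : OrbitLabel q) :
    Rel q (orbitRep q ξ i) v ↔ orbitInv q ξ v i ∧ orbitCond q ξ v i := by
  have hq0 : q ≠ 0 := by rintro rfl; simp at hq
  have hadd := add_pow_of_card (L := F) hF
  have hqq := pow_pow_of_card (F := F) hF
  have key {j} (h : Rel q (orbitRep q ξ j) v) : orbitInv q ξ v j ∧ orbitCond q ξ v j :=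
    ⟨h.orbitInv hadd hqq (orbitInv_orbitRep hq hF hξ j),
      h.orbitCond hq hadd hqq (orbitCond_orbitRep hq hF hξ j)⟩
  refine ⟨key, fun ⟨h1, h2⟩ => ?_⟩
  obtain ⟨j, hj⟩ := exists_rel_orbitRep hq hF hξ hv
  have hj' := hj.symm hq0 hadd
  rwa [orbitLabel_unique hq hF hξ h1 h2 (key hj').1 (key hj').2]

theorem mk_mem_orbit_orbitPoint (hq : Odd q) (hF : Fintype.card F = q ^ 2)
    (hξ : IsPrimitiveRoot ξ (q ^ 2 - 1)) {v : Fin 4 → F} (hv : v ≠ 0) (i : OrbitLabel q) :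
    (.mk F v hv : PG3 F) ∈ MulAction.orbit (groupG F q) (orbitPoint q ξ i) ↔
      orbitInv q ξ v i ∧ orbitCond q ξ v i := by
  rw [orbitPoint, mk_mem_orbit_groupG hq hF, rel_orbitRep_iff hq hF hξ hv]

end Orbits

/-! ### K-orbits, and the orbits as the sets of the list -/

section KOrbits

variable {F : Type*} [Field F] {q : ℕ} {ξ : F}

/-- For V = V* one has h = 2D with D in F_q; the scalar multiple is harmless. -/
theorem IsHermitian.hermForm_sq (hq : Odd q) (hadd : ∀ x y : F, (x + y) ^ q = x ^ q + y ^ q)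
    (hqq : ∀ x : F, (x ^ q) ^ q = x) {v : Fin 4 → F} (h : IsHermitian q v) :
    hermForm q v ^ 2 = 4 * quadForm v ^ (q + 1) := by
  obtain ⟨k, hk, h0, h2, h3⟩ := h
  refine (rel_smul (by rintro rfl; simp at hq) hk v).hermForm_sq_eq hadd hqq ?_
  have h1 : (k * v 2) ^ q = k * v 1 := by rw [h2, hqq]
  have e1 : hermForm q (k • v) = 2 * quadForm (k • v) := by
    simp only [hermForm, quadForm, Pi.smul_apply, smul_eq_mul, pow_succ, h0, h1, h3, ← h2]
    ring
  have e2 : quadForm (k • v) ^ q = quadForm (k • v) := by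
    simp only [quadForm, Pi.smul_apply, smul_eq_mul, sub_pow_of_add_pow hadd, mul_pow (_ * _) (_ * _),
      h0, h1, h3, ← h2]
    ring
  rw [e1, pow_succ (quadForm _), e2]
  ring

theorem isHermitian_of_mem_setO (hqq : ∀ x : F, (x ^ q) ^ q = x) (hq0 : q ≠ 0) {v : Fin 4 → F}
    {hv : v ≠ 0} (h : (.mk F v hv : PG3 F) ∈ setO F q) : IsHermitian q v := by
  rw [← mk_mem_baerSigma hv]
  rcases h with ⟨t, h⟩ | h
  · refine ⟨1, t, t ^ (q + 1), vec_one_ne_zero F _ _ _, one_pow q, ?_, h⟩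
    rw [pow_succ, mul_pow, hqq, mul_comm]
  · have e : (![0, 0, 0 ^ q, 1] : Fin 4 → F) = ![0, 0, 0, 1] := by rw [zero_pow hq0]
    refine ⟨0, 0, 1, by rw [e]; exact vec_last_ne_zero F, zero_pow hq0, one_pow q, ?_⟩
    rw [Set.mem_singleton_iff.1 h]
    congr 1
    exact e.symm

variable [Fintype F]

/-- If `(0, ξ; 1, 0)` fixes a point, then its `K`-orbit is its `G`-orbit. -/
theorem kOrbit_eq_orbit (hq : Odd q) (hF : Fintype.card F = q ^ 2)
    (hξ : IsPrimitiveRoot ξ (q ^ 2 - 1)) {v : Fin 4 → F} (hv : v ≠ 0) {k : F} (hk : k ≠ 0)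
    (hS : (frobTensor q !![0, ξ; 1, 0]).mulVec v = k • v) :
    {P | ∃ g ∈ groupK F q, P = g • (.mk F v hv : PG3 F)} =
      MulAction.orbit (groupG F q) (.mk F v hv : PG3 F) := by
  have hq0 : q ≠ 0 := by rintro rfl; simp at hq
  have hadd := add_pow_of_card (L := F) hF
  have hξ0 := ne_zero_of_isPrimitiveRoot hq hF hξ
  ext P
  induction P using Projectivization.ind with | h w hw =>
  rw [mk_mem_orbit_groupG hq hF]
  constructor
  · rintro ⟨_, ⟨A, M, hM, rfl⟩, h⟩
    rw [mk_smul_mk _ hv (mulVec_ne_zero _ hv) rfl, eq_comm, Projectivization.mk_eq_mk_iff] at h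
    obtain ⟨c, hc⟩ := h
    refine ⟨A.1, by rw [A.2]; exact one_ne_zero, c, c.ne_zero, ?_⟩
    rw [← hM, ← hc]
    rfl
  · rintro ⟨A, hA, c, hc, h⟩
    obtain ⟨B, hB, hBs, d, hd, h'⟩ : ∃ B : Matrix (Fin 2) (Fin 2) F, B.det ≠ 0 ∧ IsSquare B.det ∧
        ∃ d : F, d ≠ 0 ∧ (frobTensor q B).mulVec v = d • w := by
      -- If det A is a nonsquare, composing with the given element of the stabiliser, whose
      -- determinant -ξ is a nonsquare, makes it a square s². Dividing by s then lands in SL(2).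
      by_cases hA' : IsSquare A.det
      · exact ⟨A, hA, hA', c, hc, h⟩
      · refine ⟨A * !![0, ξ; 1, 0], ?_, ?_, k * c, mul_ne_zero hk hc, ?_⟩
        · rw [Matrix.det_mul, Matrix.det_fin_two_of]
          exact mul_ne_zero hA (by simpa)
        · obtain ⟨n, hn⟩ := exists_pow_eq_of_ne_zero (sq_sub_one_eq hq ▸ hξ)
            (card_eq_mul_add_one hq hF) hA
          rw [Matrix.det_mul, Matrix.det_fin_two_of, hn]
          have : ξ ^ n * (0 * 0 - ξ * 1) = -1 * ξ ^ (n + 1) := by ring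
          rw [this]
          refine (isSquare_neg_one hq hξ hF).mul (Even.isSquare_pow ?_ _)
          by_contra hn'
          apply hA'
          rw [hn]
          exact Even.isSquare_pow (by
            rw [Nat.even_add_one, not_not] at hn'
            exact hn') _
        · rw [frobTensor_mul hadd, ← Matrix.mulVec_mulVec, hS, Matrix.mulVec_smul, h, smul_smul]
    obtain ⟨s, hs⟩ := hBs
    have hs0 : s ≠ 0 := by rintro rfl; simp [hs] at hB
    let C : SL(2, F) := ⟨s⁻¹ • B, by
      rw [Matrix.det_smul, hs, Fintype.card_fin]
      field_simp⟩
    let M := frobGL hq0 hadd (Matrix.SpecialLinearGroup.toGL C)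
    refine ⟨_, ⟨C, M, rfl, rfl⟩, ?_⟩
    have e : M.1.mulVec v = (s⁻¹ ^ (q + 1) * d) • w := by
      change (frobTensor q (s⁻¹ • B)).mulVec v = _
      rw [frobTensor_smul, Matrix.smul_mulVec, h', smul_smul]
    rw [mk_smul_mk M hv (mulVec_ne_zero _ hv) rfl, eq_comm, Projectivization.mk_eq_mk_iff']
    exact ⟨_, e.symm⟩

theorem frobTensor_swap_mulVec_orbitRep_four (hq : Odd q) (hF : Fintype.card F = q ^ 2)
    (hξ : IsPrimitiveRoot ξ (q ^ 2 - 1)) :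
    (frobTensor q !![0, ξ; 1, 0]).mulVec (orbitRep q ξ (.inl 4)) =
      ξ ^ ((q + 1) / 2) • orbitRep q ξ (.inl 4) := by
  have hq0 : q ≠ 0 := by rintro rfl; simp at hq
  have e : ξ ^ q * ξ = ξ ^ ((q + 1) / 2) * ξ ^ ((q + 1) / 2) := by
    rw [← pow_succ, ← pow_add]
    obtain ⟨m, rfl⟩ := hq
    congr 1
    omega
  rw [frobTensor_mulVec]
  ext i
  fin_cases i <;> simp [orbitRep, hq0, e]

theorem frobTensor_swap_mulVec_orbitRep_five (hq : Odd q) (hF : Fintype.card F = q ^ 2)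
    (hξ : IsPrimitiveRoot ξ (q ^ 2 - 1)) :
    (frobTensor q !![0, ξ; 1, 0]).mulVec (orbitRep q ξ (.inl 5)) =
      ξ ^ ((q + 1) / 2) • orbitRep q ξ (.inl 5) := by
  have hq0 : q ≠ 0 := by rintro rfl; simp at hq
  have e1 : ξ ^ q = ξ ^ ((q + 1) / 2) * ξ ^ ((q - 1) / 2) := by
    rw [← pow_add]
    obtain ⟨m, rfl⟩ := hq
    congr 1
    omega
  have e2 : ξ * ξ ^ ((q - 1) / 2) = ξ ^ ((q + 1) / 2) := by
    rw [← pow_succ']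
    obtain ⟨m, rfl⟩ := hq
    congr 1
    omega
  rw [frobTensor_mulVec]
  ext i
  fin_cases i <;> simp [orbitRep, hq0, e1, e2]

/-- Each set of the list is the orbit of its representative. -/
theorem orbit_orbitPoint (hq : Odd q) (hF : Fintype.card F = q ^ 2)
    (hξ : IsPrimitiveRoot ξ (q ^ 2 - 1)) (i : OrbitLabel q) :
    MulAction.orbit (groupG F q) (orbitPoint q ξ i) = orbitSet q ξ i := by
  have hq0 : q ≠ 0 := by rintro rfl; simp at hq
  have h3 := three_le_of_card hq hF
  have hadd := add_pow_of_card (L := F) hF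
  have hqq := pow_pow_of_card (F := F) hF
  have hξ0 := ne_zero_of_isPrimitiveRoot hq hF hξ
  have hη0 : ξ ^ ((q + 1) / 2) ≠ 0 := pow_ne_zero _ hξ0
  have half : ξ ^ ((q - 1) * ((q + 1) / 2)) = -1 := pow_half_eq_neg_one hq hF hξ
  have herm_zero {J : F} {v : Fin 4 → F} (hD : quadForm v = 0)
      (h : hermForm q v ^ 2 = J * quadForm v ^ (q + 1)) : hermForm q v = 0 := by
    rw [hD, zero_pow (by omega), mul_zero] at h
    exact pow_eq_zero_iff two_ne_zero |>.1 h
  -- On D = 0 the surface equation forces h = 0, so removing 𝒪 amounts to requiring D ≠ 0.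
  have key {a b J : F} {v : Fin 4 → F} (hv : v ≠ 0) (hab : a * b = -1)
      (hJ : a ^ 2 + (a ^ 2)⁻¹ + 2 = J) :
      (quadForm v ≠ 0 ∧ hermForm q v ^ 2 = J * quadForm v ^ (q + 1)) ↔
        (.mk F v hv : PG3 F) ∈ (surface q (a + a⁻¹) ∪ surface q (b + b⁻¹)) \ setO F q := by
    rw [Set.mem_sdiff, mk_mem_surface_union hq hab, mk_mem_setO hq0 hadd hqq, hJ]
    constructor
    · rintro ⟨h1, h2⟩
      exact ⟨h2, fun h => h1 h.1⟩
    · rintro ⟨h1, h2⟩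
      exact ⟨fun h => h2 ⟨h, herm_zero h h1⟩, h1⟩
  by_cases h4 : i = .inl 4
  · subst h4
    exact (kOrbit_eq_orbit hq hF hξ (orbitRep_ne_zero _) hη0
      (frobTensor_swap_mulVec_orbitRep_four hq hF hξ)).symm
  by_cases h5 : i = .inl 5
  · subst h5
    exact (kOrbit_eq_orbit hq hF hξ (orbitRep_ne_zero _) hη0
      (frobTensor_swap_mulVec_orbitRep_five hq hF hξ)).symm
  ext P
  induction P using Projectivization.ind with | h v hv =>
  rw [mk_mem_orbit_orbitPoint hq hF hξ hv]
  rcases i with i | j | k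
  · fin_cases i
    · exact (mk_mem_setO hq0 hadd hqq hv).symm
    · simp only [orbitInv, orbitCond, orbitSet]
      rw [Set.mem_sdiff, mk_mem_hypQuadric, mk_mem_setO hq0 hadd hqq]
      tauto
    · simp only [orbitInv, orbitCond, orbitSet, orbitExp]
      rw [Set.mem_sdiff, mk_mem_baerSigma, mk_mem_setO hq0 hadd hqq, invariantJ_zero]
      constructor
      · rintro ⟨⟨h1, -⟩, h2⟩
        exact ⟨h2, fun h => h1 h.1⟩
      · rintro ⟨h1, h2⟩
        have h := h1.hermForm_sq hq hadd hqq
        exact ⟨⟨fun hD => h2 ⟨hD, herm_zero hD h⟩, h⟩, h1⟩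
    · simp only [orbitInv, orbitCond, orbitSet, orbitExp]
      rw [mergedE0, surfE, surfE, Set.mem_sdiff, mk_mem_surface_union hq (by simp [half]),
        mk_mem_baerSigma, invariantJ_zero]
      have e : (ξ ^ (0 * ((q + 1) / 2))) ^ 2 + ((ξ ^ (0 * ((q + 1) / 2))) ^ 2)⁻¹ + 2 = 4 := by
        simp
        norm_num
      rw [e]
      constructor
      · rintro ⟨⟨-, h1⟩, h2⟩
        exact ⟨h1, h2⟩
      · rintro ⟨h1, h2⟩
        -- The points with D = 0 lie in 𝒪 ⊆ Σ, so removing Σ already excludes them.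
        exact ⟨⟨fun hD => h2 (isHermitian_of_mem_setO hqq hq0
          ((mk_mem_setO hq0 hadd hqq hv).2 ⟨hD, herm_zero hD h1⟩)), h1⟩, h2⟩
    · exact absurd rfl h4
    · exact absurd rfl h5
  · simp only [orbitInv, orbitCond, orbitSet, orbitExp, and_true]
    have hj := j.2
    refine key hv ?_ ?_
    · rw [← pow_add, ← half]
      congr 1
      obtain ⟨m, rfl⟩ := hq
      rw [← add_mul, Nat.add_sub_cancel' (by omega),
        show (2 * m + 1 + 1) / 2 = m + 1 by omega, show 2 * m + 1 - 1 = 2 * m by omega,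
        show 2 * m / 2 = m by omega]
      ring
    · rw [invariantJ, ← pow_mul, show (j.1 + 1) * ((q - 1) / 2) * 2 = (q - 1) * (j.1 + 1) by
        obtain ⟨m, rfl⟩ := hq
        rw [mul_assoc, mul_comm, Nat.div_mul_cancel ⟨m, by omega⟩]]
  · simp only [orbitInv, orbitCond, orbitSet, orbitExp, and_true]
    have hk := k.2
    refine key hv ?_ ?_
    · rw [← pow_add, ← half, ← add_mul, Nat.add_sub_cancel' (by omega)]
    · rw [invariantJ, ← pow_mul, show (k.1 + 1) * ((q + 1) / 2) * 2 = (q + 1) * (k.1 + 1) by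
        obtain ⟨m, rfl⟩ := hq
        rw [mul_assoc, mul_comm, Nat.div_mul_cancel ⟨m + 1, by omega⟩]]

end KOrbits

/-! ### The list of orbits, for G and for G' -/

section OrbitLists

variable {F : Type*} [Field F] {q : ℕ} {ξ : F}

theorem orbitInv_swap {v : Fin 4 → F} {i : OrbitLabel q} (h : orbitInv q ξ v i) :
    orbitInv q ξ ![v 0, v 2, v 1, v 3] i := by
  have e1 : quadForm ![v 0, v 2, v 1, v 3] = quadForm v := by
    simp [quadForm, mul_comm]
  have e2 : hermForm q ![v 0, v 2, v 1, v 3] = hermForm q v := by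
    simp [hermForm, sub_right_comm]
  rcases i with i | i | i
  · fin_cases i <;> simpa only [orbitInv, e1, e2] using h
  · simpa only [orbitInv, e1, e2] using h
  · simpa only [orbitInv, e1, e2] using h

theorem IsHermitian.swap (hqq : ∀ x : F, (x ^ q) ^ q = x) {v : Fin 4 → F} (h : IsHermitian q v) :
    IsHermitian q ![v 0, v 2, v 1, v 3] := by
  obtain ⟨k, hk, h0, h2, h3⟩ := h
  exact ⟨k, hk, h0, by simp [h2, hqq], h3⟩

theorem orbitCond_swap (hqq : ∀ x : F, (x ^ q) ^ q = x) {v : Fin 4 → F} {i : OrbitLabel q}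
    (h : orbitCond q ξ v i) : orbitCond q ξ ![v 0, v 2, v 1, v 3] i := by
  have e1 : quadForm ![v 0, v 2, v 1, v 3] = quadForm v := by
    simp [quadForm, mul_comm]
  have e2 : hermForm q ![v 0, v 2, v 1, v 3] = hermForm q v := by
    simp [hermForm, sub_right_comm]
  rcases i with i | i
  · fin_cases i
    · simpa only [orbitCond, e2] using h
    · simpa only [orbitCond, e2] using h
    · exact IsHermitian.swap hqq h
    · intro h'
      apply h
      convert h'.swap hqq
      ext i
      fin_cases i <;> rfl
    · simpa only [orbitCond, e1] using h
    · simpa only [orbitCond, e1] using h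
  · trivial

variable [Fintype F]

theorem orbitSet_injective (hq : Odd q) (hF : Fintype.card F = q ^ 2)
    (hξ : IsPrimitiveRoot ξ (q ^ 2 - 1)) : Function.Injective (orbitSet q ξ) := by
  intro i j h
  rw [← orbit_orbitPoint hq hF hξ, ← orbit_orbitPoint hq hF hξ] at h
  have := h ▸ MulAction.mem_orbit_self (M := groupG F q) (orbitPoint q ξ i)
  obtain ⟨h1, h2⟩ := (mk_mem_orbit_orbitPoint hq hF hξ (orbitRep_ne_zero i) j).1 this
  exact orbitLabel_unique hq hF hξ (orbitInv_orbitRep hq hF hξ i) (orbitCond_orbitRep hq hF hξ i)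
    h1 h2

theorem exists_mem_orbit_orbitPoint (hq : Odd q) (hF : Fintype.card F = q ^ 2)
    (hξ : IsPrimitiveRoot ξ (q ^ 2 - 1)) (P : PG3 F) :
    ∃ i, P ∈ MulAction.orbit (groupG F q) (orbitPoint q ξ i) := by
  have hq0 : q ≠ 0 := by rintro rfl; simp at hq
  have hadd := add_pow_of_card (L := F) hF
  induction P using Projectivization.ind with | h v hv =>
  obtain ⟨i, hi⟩ := exists_rel_orbitRep hq hF hξ hv
  exact ⟨i, (mk_mem_orbit_groupG hq hF _ hv).2 (hi.symm hq0 hadd)⟩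

theorem pointOrbits_groupG (hq : Odd q) (hF : Fintype.card F = q ^ 2)
    (hξ : IsPrimitiveRoot ξ (q ^ 2 - 1)) : pointOrbits (groupG F q) = orbitList q ξ := by
  rw [orbitList_eq_range]
  ext X
  constructor
  · rintro ⟨P, rfl⟩
    obtain ⟨i, hi⟩ := exists_mem_orbit_orbitPoint hq hF hξ P
    exact ⟨i, by rw [← orbit_orbitPoint hq hF hξ]; exact (MulAction.orbit_eq_iff.2 hi).symm⟩
  · rintro ⟨i, rfl⟩
    exact ⟨orbitPoint q ξ i, orbit_orbitPoint hq hF hξ i⟩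

theorem ncard_orbitList (hq : Odd q) (hF : Fintype.card F = q ^ 2)
    (hξ : IsPrimitiveRoot ξ (q ^ 2 - 1)) : (orbitList q ξ).ncard = q + 4 := by
  have h3 := three_le_of_card hq hF
  rw [orbitList_eq_range, ← Set.image_univ,
    Set.ncard_image_of_injective _ (orbitSet_injective hq hF hξ), Set.ncard_univ]
  simp only [Nat.card_eq_fintype_card, Fintype.card_sum, Fintype.card_fin]
  obtain ⟨m, rfl⟩ := hq
  omega

/-- Transposition preserves D, h and the Hermitian property, hence every condition that defines an
orbit. -/
theorem iota_smul_mem_orbit (hq : Odd q) (hF : Fintype.card F = q ^ 2)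
    (hξ : IsPrimitiveRoot ξ (q ^ 2 - 1)) (P : PG3 F) :
    iota F • P ∈ MulAction.orbit (groupG F q) P := by
  obtain ⟨i, hi⟩ := exists_mem_orbit_orbitPoint hq hF hξ P
  rw [MulAction.orbit_eq_iff.2 hi]
  induction P using Projectivization.ind with | h v hv =>
  have hv' : ![v 0, v 2, v 1, v 3] ≠ 0 := by
    intro h
    apply hv
    have h0 := congrFun h 0
    have h1 := congrFun h 1
    have h2 := congrFun h 2
    have h3 := congrFun h 3
    simp at h0 h1 h2 h3
    ext i
    fin_cases i <;> simp [h0, h1, h2, h3]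
  rw [mk_mem_orbit_orbitPoint hq hF hξ hv] at hi
  rw [iota_smul_mk hv hv' rfl, mk_mem_orbit_orbitPoint hq hF hξ hv']
  exact ⟨orbitInv_swap hi.1, orbitCond_swap (pow_pow_of_card hF) hi.2⟩

theorem pointOrbits_groupG' (hq : Odd q) (hF : Fintype.card F = q ^ 2)
    (hξ : IsPrimitiveRoot ξ (q ^ 2 - 1)) :
    pointOrbits (groupG' F q) = pointOrbits (groupG F q) := by
  have h3 := three_le_of_card hq hF
  have key (P : PG3 F) : MulAction.orbit (groupG' F q) P = MulAction.orbit (groupG F q) P := by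
    apply Set.Subset.antisymm
    · rintro _ ⟨⟨g, hg⟩, rfl⟩
      change g • P ∈ _
      rcases mem_groupG_or_mul_iota_mem h3 hF hg with h | h
      · exact ⟨⟨g, h⟩, rfl⟩
      · have e : g • P = (g * iota F) • iota F • P := by
          rw [smul_smul, mul_assoc, iota_mul_iota, mul_one]
        rw [e]
        obtain ⟨⟨k, hk⟩, hk'⟩ := iota_smul_mem_orbit hq hF hξ P
        refine ⟨⟨_, mul_mem h hk⟩, ?_⟩
        rw [← hk']
        exact mul_smul (g * iota F) k P
    · rintro _ ⟨⟨g, hg⟩, rfl⟩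
      exact ⟨⟨g, groupG_le_groupG' hg⟩, rfl⟩
  simp only [pointOrbits, key]

/-- These are the two orbits with invariant 0, that is h = 0 and D ≠ 0; the square-class condition
splits them. -/
theorem setH1_union_setH2 (hq : Odd q) (hF : Fintype.card F = q ^ 2)
    (hξ : IsPrimitiveRoot ξ (q ^ 2 - 1)) :
    setH1 q ξ ∪ setH2 q ξ = hermSurface F q \ setO F q := by
  have hq0 : q ≠ 0 := by rintro rfl; simp at hq
  have hadd := add_pow_of_card (L := F) hF
  have hqq := pow_pow_of_card (F := F) hF
  have e1 := orbit_orbitPoint hq hF hξ (.inl 4)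
  have e2 := orbit_orbitPoint hq hF hξ (.inl 5)
  simp only [orbitSet] at e1 e2
  ext P
  induction P using Projectivization.ind with | h v hv =>
  rw [Set.mem_union, ← e1, ← e2, mk_mem_orbit_orbitPoint hq hF hξ hv,
    mk_mem_orbit_orbitPoint hq hF hξ hv, Set.mem_sdiff, mk_mem_hermSurface,
    mk_mem_setO hq0 hadd hqq]
  simp only [orbitInv, orbitCond, orbitExp, invariantJ_half hq hF hξ, zero_mul,
    pow_eq_zero_iff two_ne_zero]
  tauto

end OrbitLists

/-! ### Sizes of ℋ₁ and ℋ₂ by orbit-stabiliser -/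

section Counting

variable {F : Type*} [Field F] [Fintype F] {q : ℕ} {ξ : F}

/-- The matrices that are diagonal or antidiagonal, with entries related by `n`-th powers. -/
def IsMonomial (ξ : F) (n : ℕ) (A : Matrix (Fin 2) (Fin 2) F) : Prop :=
  (A 0 1 = 0 ∧ A 1 0 = 0 ∧ A 0 0 ^ n = A 1 1 ^ n) ∨
    (A 0 0 = 0 ∧ A 1 1 = 0 ∧ A 0 1 ^ n = (ξ * A 1 0) ^ n)

theorem card_isMonomial {ζ : F} {n : ℕ} (hn : n ≠ 0) (hζ : IsPrimitiveRoot ζ n) (hξ0 : ξ ≠ 0) :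
    Nat.card {A : GL (Fin 2) F // IsMonomial ξ n A.1} = 2 * (n * (Fintype.card F - 1)) := by
  classical
  have := NeZero.mk hn
  -- Parameters: the shape (diagonal or antidiagonal), the n-th root of unity by which the two
  -- entries differ, and one free nonzero entry.
  let f : Bool × rootsOfUnity n F × Fˣ → {A : GL (Fin 2) F // IsMonomial ξ n A.1}
    | (false, z, x) => ⟨Matrix.GeneralLinearGroup.mkOfDetNeZero
        !![((z : Fˣ) : F) * x, 0; 0, (x : F)] (by simp [Matrix.det_fin_two_of]), by
        left
        have hz : (((z : Fˣ) : F)) ^ n = 1 := by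
          have := z.2
          rw [mem_rootsOfUnity'] at this
          exact this
        simp [Matrix.GeneralLinearGroup.mkOfDetNeZero, mul_pow, hz]⟩
    | (true, z, x) => ⟨Matrix.GeneralLinearGroup.mkOfDetNeZero
        !![0, ((z : Fˣ) : F) * (ξ * x); (x : F), 0] (by simp [Matrix.det_fin_two_of, hξ0]), by
        right
        have hz : (((z : Fˣ) : F)) ^ n = 1 := by
          have := z.2
          rw [mem_rootsOfUnity'] at this
          exact this
        simp [Matrix.GeneralLinearGroup.mkOfDetNeZero, mul_pow, hz]⟩
  have hf : Function.Bijective f := by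
    constructor
    · rintro ⟨_ | _, z, x⟩ ⟨_ | _, z', x'⟩ h
      all_goals
        have h := congrArg (fun A => A.1.1) h
        have h00 := congrFun (congrFun h 0) 0
        have h01 := congrFun (congrFun h 0) 1
        have h10 := congrFun (congrFun h 1) 0
        have h11 := congrFun (congrFun h 1) 1
        simp [f, Matrix.GeneralLinearGroup.mkOfDetNeZero] at h00 h01 h10 h11
      · obtain rfl := Units.ext h11
        have hz : z = z' := Subtype.ext (Units.ext (by simpa using h00))
        rw [hz]
      · obtain rfl := Units.ext h10
        have hz : z = z' := Subtype.ext (Units.ext (by simpa [hξ0] using h01))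
        rw [hz]
    · rintro ⟨A, h⟩
      have hdet := A.det_ne_zero
      rw [Matrix.det_fin_two] at hdet
      rcases h with ⟨h01, h10, h⟩ | ⟨h00, h11, h⟩
      · rw [h01, zero_mul, sub_zero, mul_ne_zero_iff] at hdet
        refine ⟨(false, rootsOfUnity.mkOfPowEq (A.1 0 0 / A.1 1 1) ?_, Units.mk0 _ hdet.2), ?_⟩
        · rw [div_pow, h, div_self (pow_ne_zero n hdet.2)]
        · apply Subtype.ext
          apply Units.ext
          ext i j
          fin_cases i <;> fin_cases j <;>
            simp [f, Matrix.GeneralLinearGroup.mkOfDetNeZero, h01, h10, hdet.2]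
      · rw [h00, zero_mul, zero_sub, neg_ne_zero, mul_ne_zero_iff] at hdet
        have hne : ξ * A.1 1 0 ≠ 0 := mul_ne_zero hξ0 hdet.2
        refine ⟨(true, rootsOfUnity.mkOfPowEq (A.1 0 1 / (ξ * A.1 1 0)) ?_, Units.mk0 _ hdet.2), ?_⟩
        · rw [div_pow, h, div_self (pow_ne_zero n hne)]
        · apply Subtype.ext
          apply Units.ext
          ext i j
          fin_cases i <;> fin_cases j <;>
            simp [f, Matrix.GeneralLinearGroup.mkOfDetNeZero, h00, h11, hdet.2, hξ0]
  rw [← Nat.card_eq_of_bijective f hf]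
  rw [Nat.card_prod, Nat.card_prod, hζ.card_rootsOfUnity, Nat.card_eq_fintype_card,
    Nat.card_eq_fintype_card, Fintype.card_units, Fintype.card_bool]

theorem card_GL_two (hF : Fintype.card F = q ^ 2) :
    Nat.card (GL (Fin 2) F) = (q ^ 2 + 1) * q ^ 2 * (q ^ 2 - 1) * (q ^ 2 - 1) := by
  rw [Matrix.card_GL_field, hF]
  simp only [Fin.prod_univ_two, Fin.val_zero, Fin.val_one, pow_zero, pow_one]
  rcases Nat.eq_zero_or_pos q with rfl | hq
  · simp
  · obtain ⟨n, hn⟩ : ∃ n, q ^ 2 = n + 1 :=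
      Nat.exists_eq_succ_of_ne_zero (pow_ne_zero 2 hq.ne')
    rw [hn, Nat.add_sub_cancel]
    have e1 : (n + 1) ^ 2 - 1 = (n + 2) * n := by
      rw [show (n + 1) ^ 2 = (n + 2) * n + 1 by ring, Nat.add_sub_cancel]
    have e2 : (n + 1) ^ 2 - (n + 1) = (n + 1) * n := by
      rw [show (n + 1) ^ 2 = (n + 1) * n + (n + 1) by ring, Nat.add_sub_cancel]
    rw [e1, e2]
    ring

/-- Orbit-stabiliser for the action of `GL(2)` through `A ↦ A^q ⊗ A`. -/
theorem ncard_orbit_mul_card (hq : Odd q) (hF : Fintype.card F = q ^ 2) {v : Fin 4 → F}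
    (hv : v ≠ 0) :
    (MulAction.orbit (groupG F q) (.mk F v hv : PG3 F)).ncard *
      Nat.card {A : GL (Fin 2) F // ∃ c : F, c ≠ 0 ∧ (frobTensor q A.1).mulVec v = c • v} =
        Nat.card (GL (Fin 2) F) := by
  classical
  have hq0 : q ≠ 0 := by rintro rfl; simp at hq
  have hadd := add_pow_of_card (L := F) hF
  let φ : GL (Fin 2) F →* PGL(4, F) := Matrix.ProjGenLinGroup.mk.comp (frobGL hq0 hadd)
  let _ : MulAction (GL (Fin 2) F) (PG3 F) := MulAction.compHom (PG3 F) φ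
  have smul_eq {w : Fin 4 → F} (hw : w ≠ 0) (A : GL (Fin 2) F) :
      A • (.mk F v hv : PG3 F) = .mk F w hw ↔
        ∃ c : F, c ≠ 0 ∧ (frobTensor q A.1).mulVec v = c • w := by
    change Matrix.ProjGenLinGroup.mk (frobGL hq0 hadd A) • (.mk F v hv : PG3 F) = .mk F w hw ↔ _
    rw [mk_smul_mk _ hv (mulVec_ne_zero _ hv) rfl, Projectivization.mk_eq_mk_iff]
    constructor
    · rintro ⟨c, hc⟩
      exact ⟨c, c.ne_zero, hc.symm⟩
    · rintro ⟨c, hc, h⟩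
      exact ⟨Units.mk0 c hc, h.symm⟩
  have horb : MulAction.orbit (groupG F q) (.mk F v hv : PG3 F) =
      MulAction.orbit (GL (Fin 2) F) (.mk F v hv : PG3 F) := by
    ext P
    induction P using Projectivization.ind with | h w hw =>
    rw [mk_mem_orbit_groupG hq hF]
    constructor
    · rintro ⟨A, hA, h⟩
      exact ⟨Matrix.GeneralLinearGroup.mkOfDetNeZero A hA, (smul_eq hw _).2 h⟩
    · rintro ⟨A, h⟩
      exact ⟨A.1, A.det_ne_zero, (smul_eq hw A).1 h⟩
  have hstab : Nat.card (MulAction.stabilizer (GL (Fin 2) F) (.mk F v hv : PG3 F)) =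
      Nat.card {A : GL (Fin 2) F // ∃ c : F, c ≠ 0 ∧ (frobTensor q A.1).mulVec v = c • v} :=
    Nat.card_congr (Equiv.subtypeEquivRight fun A => smul_eq hv A)
  rw [horb, ← hstab, ← Nat.card_coe_set_eq, ← Nat.card_prod]
  exact Nat.card_congr (MulAction.orbitProdStabilizerEquivGroup (GL (Fin 2) F) _)

theorem two_mul_ncard_orbit (hq : Odd q) (hF : Fintype.card F = q ^ 2)
    (hξ : IsPrimitiveRoot ξ (q ^ 2 - 1)) {n m : ℕ} (hnm : n * m = q ^ 2 - 1) {v : Fin 4 → F}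
    (hv : v ≠ 0)
    (h : ∀ A : GL (Fin 2) F, (∃ c : F, c ≠ 0 ∧ (frobTensor q A.1).mulVec v = c • v) ↔
      IsMonomial ξ n A.1) :
    2 * (MulAction.orbit (groupG F q) (.mk F v hv : PG3 F)).ncard = q ^ 2 * (q ^ 2 + 1) * m := by
  have h3 := three_le_of_card hq hF
  have hpos : 0 < q ^ 2 - 1 := by
    have := Nat.pow_le_pow_left h3 2
    omega
  have hn : n ≠ 0 := by rintro rfl; omega
  have hζ := hξ.pow hpos (show q ^ 2 - 1 = m * n by rw [← hnm, mul_comm])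
  have := ncard_orbit_mul_card hq hF hv
  rw [Nat.card_congr (Equiv.subtypeEquivRight h),
    card_isMonomial hn hζ (ne_zero_of_isPrimitiveRoot hq hF hξ), hF, card_GL_two hF] at this
  apply Nat.eq_of_mul_eq_mul_right (Nat.mul_pos (Nat.pos_of_ne_zero hn) hpos)
  calc _ = _ := by rw [mul_comm 2, mul_assoc, this]
    _ = (q ^ 2 + 1) * q ^ 2 * (n * m) * (q ^ 2 - 1) := by rw [hnm]
    _ = _ := by ring

theorem fixes_orbitRep_four_iff (hq : Odd q) (hF : Fintype.card F = q ^ 2)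
    (hξ : IsPrimitiveRoot ξ (q ^ 2 - 1)) (A : GL (Fin 2) F) :
    (∃ c : F, c ≠ 0 ∧ (frobTensor q A.1).mulVec (orbitRep q ξ (.inl 4)) =
      c • orbitRep q ξ (.inl 4)) ↔ IsMonomial ξ (q + 1) A.1 := by
  have hq0 : q ≠ 0 := by rintro rfl; simp at hq
  have hadd := add_pow_of_card (L := F) hF
  have hqq := pow_pow_of_card (F := F) hF
  have h2 := two_ne_zero_of_card hq hF
  have hη := pow_half_pow hq hF hξ
  have hη0 : ξ ^ ((q + 1) / 2) ≠ 0 := pow_ne_zero _ (ne_zero_of_isPrimitiveRoot hq hF hξ)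
  have hηη : ξ ^ ((q + 1) / 2) * ξ ^ ((q + 1) / 2) = ξ ^ (q + 1) := by
    rw [← pow_add]
    obtain ⟨m, rfl⟩ := hq
    congr 1
    omega
  have hdet := A.det_ne_zero
  rw [Matrix.det_fin_two] at hdet
  simp only [orbitRep, frobTensor_mulVec, IsMonomial]
  generalize ξ ^ ((q + 1) / 2) = η at *
  generalize A.1 0 0 = a at *
  generalize A.1 0 1 = b at *
  generalize A.1 1 0 = c at *
  generalize A.1 1 1 = d at *
  simp only [mul_pow ξ, ← hηη]
  constructor
  · rintro ⟨k, hk, h⟩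
    have e0 := congrFun h 0
    have e1 := congrFun h 1
    have e2 := congrFun h 2
    have e3 := congrFun h 3
    simp at e0 e1 e2 e3
    -- Conjugating one off-diagonal equation flips the sign of η, as η^q = -η; adding it to the
    -- other leaves 2bd^q = 0.
    have e1' := congrArg (· ^ q) e1
    simp [hadd, mul_pow, hqq, hη, hq0] at e1'
    have hbd : b * d ^ q = 0 := by
      have : 2 * (b * d ^ q) = 0 := by linear_combination e2 + e1'
      exact (mul_eq_zero.1 this).resolve_left h2
    rcases mul_eq_zero.1 hbd with hb | hd
    · left
      have had : a ≠ 0 ∧ d ≠ 0 := by simpa [hb] using hdet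
      have hc : c = 0 := by simpa [hb, hq0, had.1, hη0] using e1
      refine ⟨hb, hc, ?_⟩
      simp [hb, hc, hq0] at e0 e3
      apply mul_right_cancel₀ hη0
      linear_combination e0 - η * e3
    · right
      have hd' : d = 0 := by simpa [hq0] using hd
      have hbc : b ≠ 0 ∧ c ≠ 0 := by simpa [hd'] using hdet
      have ha : a = 0 := by simpa [hd', hq0, hbc.2, hη0] using e1
      refine ⟨ha, hd', ?_⟩
      simp [ha, hd', hq0] at e0 e3
      linear_combination e0 - η * e3
  · rintro (⟨hb, hc, h⟩ | ⟨ha, hd, h⟩)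
    · refine ⟨d ^ (q + 1), pow_ne_zero _ (by rintro rfl; simp [hb] at hdet), ?_⟩
      subst hb hc
      ext i
      fin_cases i <;> simp [hq0]
      · rw [← h]; ring
      · ring
    · refine ⟨c ^ (q + 1) * η, mul_ne_zero (pow_ne_zero _ (by rintro rfl; simp [ha] at hdet)) hη0,
        ?_⟩
      subst ha hd
      ext i
      fin_cases i <;> simp [hq0]
      · rw [← pow_succ, h]; ring
      · ring

theorem fixes_orbitRep_five_iff (hq : Odd q) (hF : Fintype.card F = q ^ 2)
    (hξ : IsPrimitiveRoot ξ (q ^ 2 - 1)) (A : GL (Fin 2) F) :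
    (∃ c : F, c ≠ 0 ∧ (frobTensor q A.1).mulVec (orbitRep q ξ (.inl 5)) =
      c • orbitRep q ξ (.inl 5)) ↔ IsMonomial ξ (q - 1) A.1 := by
  have hq0 : q ≠ 0 := by rintro rfl; simp at hq
  have hadd := add_pow_of_card (L := F) hF
  have hqq := pow_pow_of_card (F := F) hF
  have h2 := two_ne_zero_of_card hq hF
  have hη0 : ξ ^ ((q - 1) / 2) ≠ 0 := pow_ne_zero _ (ne_zero_of_isPrimitiveRoot hq hF hξ)
  have hη : (ξ ^ ((q - 1) / 2)) ^ q * ξ ^ ((q - 1) / 2) = -1 := by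
    rw [← pow_succ, ← pow_mul, ← pow_half_eq_neg_one hq hF hξ]
    congr 1
    obtain ⟨m, rfl⟩ := hq
    rw [show (2 * m + 1 + 1) / 2 = m + 1 by omega, show 2 * m + 1 - 1 = 2 * m by omega,
      show 2 * m / 2 = m by omega]
    ring
  have hηη : ξ ^ ((q - 1) / 2) * ξ ^ ((q - 1) / 2) = ξ ^ (q - 1) := by
    rw [← pow_add]
    obtain ⟨m, rfl⟩ := hq
    congr 1
    omega
  have hpow (x : F) : x ^ q = x ^ (q - 1) * x := by
    rw [← pow_succ, Nat.sub_add_cancel (by omega)]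
  have hdet := A.det_ne_zero
  rw [Matrix.det_fin_two] at hdet
  simp only [orbitRep, frobTensor_mulVec, IsMonomial]
  generalize ξ ^ ((q - 1) / 2) = η at *
  generalize A.1 0 0 = a at *
  generalize A.1 0 1 = b at *
  generalize A.1 1 0 = c at *
  generalize A.1 1 1 = d at *
  simp only [mul_pow ξ, ← hηη]
  constructor
  · rintro ⟨k, hk, h⟩
    have e0 := congrFun h 0
    have e1 := congrFun h 1
    have e2 := congrFun h 2
    simp at e0 e1 e2
    have e3 := congrFun h 3
    simp at e3
    -- The equation says that the form vanishes at (x, y). Its conjugate, multiplied by η and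
    -- simplified with η^(q+1) = -1, adds up with it to 2x^q yη = 0, so the only isotropic lines are
    -- the two coordinate axes.
    have zero_of {x y : F} (e : x ^ q * (y * η) + y ^ q * x = 0) : x = 0 ∨ y = 0 := by
      have e' := congrArg (· ^ q) e
      simp [hadd, mul_pow, hqq, hq0] at e'
      have : 2 * (x ^ q * (y * η)) = 0 := by
        linear_combination e + η * e' - x * y ^ q * hη
      simpa [h2, hη0, hq0] using this
    rcases zero_of e0 with ha | hb
    · right
      have hbc : b ≠ 0 ∧ c ≠ 0 := by simpa [ha] using hdet
      have hd : d = 0 := (zero_of e3).resolve_left hbc.2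
      refine ⟨ha, hd, ?_⟩
      simp [ha, hd, hq0] at e1 e2
      rw [hpow] at e1 e2
      apply mul_right_cancel₀ (mul_ne_zero hbc.1 hbc.2)
      linear_combination e1 - η * e2
    · left
      have had : a ≠ 0 ∧ d ≠ 0 := by simpa [hb] using hdet
      have hc : c = 0 := (zero_of e3).resolve_right had.2
      refine ⟨hb, hc, ?_⟩
      simp [hb, hc, hq0] at e1 e2
      rw [hpow] at e1 e2
      apply mul_right_cancel₀ (mul_ne_zero (mul_ne_zero had.1 had.2) hη0)
      linear_combination e1 - η * e2
  · rintro (⟨hb, hc, h⟩ | ⟨ha, hd, h⟩)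
    · have had : a ≠ 0 ∧ d ≠ 0 := by simpa [hb] using hdet
      refine ⟨d ^ q * a, mul_ne_zero (pow_ne_zero _ had.2) had.1, ?_⟩
      subst hb hc
      ext i
      fin_cases i <;> simp [hq0]
      rw [hpow, hpow, h]; ring
    · have hbc : b ≠ 0 ∧ c ≠ 0 := by simpa [ha] using hdet
      refine ⟨c ^ q * (b * η), mul_ne_zero (pow_ne_zero _ hbc.2) (mul_ne_zero hbc.1 hη0), ?_⟩
      subst ha hd
      ext i
      fin_cases i <;> simp [hq0]
      rw [hpow, hpow, h]; ring

end Counting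

end HermitianVeronese

theorem mainTheorem7 {F : Type*} [Field F] [Fintype F] (q : ℕ) (hq : Odd q)
    (hF : Fintype.card F = q ^ 2) (ξ : F) (hξ : IsPrimitiveRoot ξ (q ^ 2 - 1)) :
    -- `G` is isomorphic to `PGL(2, q²)`
    Nonempty (groupG F q ≃* PGL(2, F)) ∧
    -- `G'` is the (internal) semidirect product of `G` and `⟨ι⟩`
    (groupG F q ≤ groupG' F q ∧ ((groupG F q).subgroupOf (groupG' F q)).Normal ∧
      groupG F q ⊓ Subgroup.zpowers (iota F) = ⊥ ∧
      groupG F q ⊔ Subgroup.zpowers (iota F) = groupG' F q) ∧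
    -- `ℋ₁` and `ℋ₂` make up `ℋ(3, q²) ∖ 𝒪` and have the stated sizes
    (setH1 q ξ ∪ setH2 q ξ = hermSurface F q \ setO F q ∧
      2 * (setH1 q ξ).ncard = q ^ 2 * (q ^ 2 + 1) * (q - 1) ∧
      2 * (setH2 q ξ).ncard = q ^ 2 * (q ^ 2 + 1) * (q + 1)) ∧
    -- the orbits of `G` and of `G'` are the sets of the list, and there are `q + 4` of them
    (pointOrbits (groupG F q) = orbitList q ξ ∧ (pointOrbits (groupG F q)).ncard = q + 4) ∧
    (pointOrbits (groupG' F q) = orbitList q ξ ∧ (pointOrbits (groupG' F q)).ncard = q + 4) := by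
  have h3 := three_le_of_card hq hF
  refine ⟨nonempty_groupG_mulEquiv h3 hF, ⟨groupG_le_groupG', groupG_subgroupOf_normal h3 hF,
    groupG_inf_zpowers_iota h3, groupG_sup_zpowers_iota h3 hF⟩,
    ⟨setH1_union_setH2 hq hF hξ, ?_, ?_⟩, ?_, ?_⟩
  · have h : orbitSet q ξ (.inl 4) = setH1 q ξ := rfl
    rw [← h, ← orbit_orbitPoint hq hF hξ]
    exact two_mul_ncard_orbit hq hF hξ (by rw [sq_sub_one_eq hq, mul_comm])
      (orbitRep_ne_zero _) (fixes_orbitRep_four_iff hq hF hξ)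
  · have h : orbitSet q ξ (.inl 5) = setH2 q ξ := rfl
    rw [← h, ← orbit_orbitPoint hq hF hξ]
    exact two_mul_ncard_orbit hq hF hξ (sq_sub_one_eq hq).symm
      (orbitRep_ne_zero _) (fixes_orbitRep_five_iff hq hF hξ)
  · rw [pointOrbits_groupG hq hF hξ]
    exact ⟨rfl, ncard_orbitList hq hF hξ⟩
  · rw [pointOrbits_groupG' hq hF hξ, pointOrbits_groupG hq hF hξ]
    exact ⟨rfl, ncard_orbitList hq hF hξ⟩
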